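/- Let $\Bbbk$ be an algebraically closed field of characteristic $0$, let $n\ge 1$ and let $G=\mathbb Z_{2n}\times\mathbb Z_2=\langle a,b\mid a^{2n}=b^2=1,\ ab=ba\rangle$. Let $\mathbb Z_2=\{1,x\}$ act on $G$ by automorphisms with $a\triangleleft x=ab$, $b\triangleleft x=b$. Let $\sigma:G\to\Bbbk^\times$ and $\tau:G\times G\to\Bbbk^\times$ be such that $\sigma(1)=1$, $\sigma(g\triangleleft x)=\sigma(g)$, $\tau$ is a unital $2$-cocycle, and $\sigma(gh)\sigma(g)^{-1}\sigma(h)^{-1}=\tau(g,h)\tau(g\triangleleft x,h\triangleleft x)$ for all $g,h\in G$. Let $K(8n,\sigma,\tau)$ be the Hopf algebra $\Bbbk^G\#_{\sigma,\tau}\Bbbk\mathbb Z_2$ with basis $\{e_g,e_gx\}_{g\in G}$, unit $1=\sum_g e_g$ and $$e_ge_h=\delta_{g,h}e_g,\quad xe_g=e_{g\triangleleft x}x,\quad x^2=\sum_{g}\sigma(g)e_g,\quad \Delta(e_g)=\sum_{hk=g}e_h\otimes e_k,\quad \Delta(x)=\Big[\sum_{g,h}\tau(g,h)e_g\otimes e_h\Big](x\otimes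 x),$$ $$\epsilon(x)=1,\quad \epsilon(e_g)=\delta_{g,1},\quad \mathcal S(e_g)=e_{g^{-1}},\quad \mathcal S(x)=\sum_g\sigma(g)^{-1}\tau(g,g^{-1})^{-1}e_{g\triangleleft x}x .$$ A quasitriangular structure on a Hopf algebra $H$ is an invertible $R\in H\otimes H$ with $(\Delta\otimes\mathrm{id})(R)=R_{13}R_{23}$, $(\mathrm{id}\otimes\Delta)(R)=R_{13}R_{12}$ and $\Delta^{op}(y)R=R\Delta(y)$ for all $y\in H$. Put $S=\{g\in G: g\triangleleft x=g\}$ and $T=\{g\in G:g\triangleleft x\ne g\}$. A quasitriangular structure $R$ on $K(8n,\sigma,\tau)$ is called *trivial* if $R=\sum_{g,h\in G}w(g,h)e_g\otimes e_h$ for some $w:G\times G\to\Bbbk$, and *non-trivial* if, for some functions $w^1,w^2,w^3,w^4$ with values in $\Bbbk$, $$R=\sum_{s_1,s_2\in S}w^1(s_1,s_2)e_{s_1}\otimes e_{s_2}+\sum_{s\in S,t\in T}w^2(s,t)e_sx\otimes e_t+\sum_{t\in T,s\in S}w^3(t,s)e_t\otimes e_sx+\sum_{t_1,t_2\in T}w^4(t_1,t_2)e_{t_1}x\otimes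 e_{t_2}x.\qquad(\ast)$$ Put $P_0=P_1=1$, $P_i=\prod_{m=1}^{i-1}\tau(a,a^m)$ for $i\ge 2$; $\lambda_{2i,j}=P_{2i}^{-1}\sigma(a^j)^i$, $\lambda_{2i+1,j}=P_{2i+1}^{-1}\sigma(a^j)^i$; $h(t_1,t_2)=\tau(t_1,t_2)/\tau(t_2\triangleleft x,t_1\triangleleft x)$. For $\alpha,\beta\in\Bbbk^\times$ put $S_{j,0}=\lambda_{2j+1,1}\alpha^{j+1}\beta^{j}$ and $S_{j,1}=h(a,a^{2j+1}b)\lambda_{2j+1,1}\alpha^{j}\beta^{j+1}$, and let $R'_{\alpha,\beta}$ be the element of the form $(\ast)$ with, for $0\le i,j\le n-1$ and $p,q\in\{0,1\}$, $$w^1(a^{2i}b^p,a^{2j}b^q)=\lambda_{2j,1}^{2i}(\alpha\beta)^{2ij}\sigma(a^{2j})^i,$$ $$w^2(a^{2i},a^{2j+1}b^q)=\lambda_{2i,2j+1}(S_{j,0}S_{j,1})^i,\qquad w^2(a^{2i}b,a^{2j+1}b^q)=\frac{\tau(b,a)\beta}{\tau(b,a^{2i})\alpha}\lambda_{2i,2j+1}(S_{j,0}S_{j,1})^i,$$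 $$w^3(a^{2i+1}b^p,a^{2j})=\lambda_{2j,2i+1}(S_{i,0}S_{i,1})^j,\qquad w^3(a^{2i+1}b^p,a^{2j}b)=\frac{\tau(b,a)\beta}{\tau(b,a^{2j})\alpha}\lambda_{2j,2i+1}(S_{i,0}S_{i,1})^j,$$ $$w^4(a^{2i+1},a^{2j+1})=\lambda_{2i+1,2j+1}S_{j,0}^{i+1}S_{j,1}^{i},\qquad w^4(a^{2i+1},a^{2j+1}b)=\lambda_{2i+1,2j+1}S_{j,0}^{i}S_{j,1}^{i+1},$$ $$w^4(a^{2i+1}b,a^{2j+1})=h(a^{2i+1}b,a^{2j+1})\lambda_{2i+1,2j+1}S_{j,0}^{i}S_{j,1}^{i+1},$$ $$w^4(a^{2i+1}b,a^{2j+1}b)=h(a^{2i+1}b,a^{2j+1}b)\lambda_{2i+1,2j+1}S_{j,0}^{i+1}S_{j,1}^{i}.$$ Suppose that $\eta(a,b)=1$, where $\eta(g,h)=\tau(g,h)\tau(h,g)^{-1}$. Then: 1. The set of non-trivial quasitriangular structures on $K(8n,\sigma,\tau)$ is exactly $$\Big\{R'_{\alpha,\beta}\ :\ \alpha,\beta\in\Bbbk,\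 (\alpha\beta)^n\lambda_{2n,1}=1,\ \frac{\beta^2}{\alpha^2}=\frac{\tau(b,b)}{\tau(b,a)^2}\Big\}.$$ 2. The set of trivial quasitriangular structures on $K(8n,\sigma,\tau)$ is exactly the set of elements $$\sum_{1\le i,k\le 2n,\ 1\le j,l\le 2}\alpha^{ik}\beta^{il-jk}\,e_{a^ib^j}\otimes e_{a^kb^l},\qquad \alpha,\beta\in\Bbbk,\ \alpha^{2n}=\beta^2=1.$$ -/

import Mathlib

open scoped TensorProduct

/-! ### Universal R-matrices of a Hopf algebra -/

section Quasitriangular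

variable (k H : Type*) [Field k] [Ring H] [HopfAlgebra k H]

/-- `R ↦ R₁₂ = ∑ R⁽¹⁾ ⊗ R⁽²⁾ ⊗ 1`, as a map to `H ⊗ H ⊗ H`. -/
noncomputable def leg12 : H ⊗[k] H →ₐ[k] (H ⊗[k] H) ⊗[k] H :=
  Algebra.TensorProduct.includeLeft

/-- `R ↦ R₁₃ = ∑ R⁽¹⁾ ⊗ 1 ⊗ R⁽²⁾`. -/
noncomputable def leg13 : H ⊗[k] H →ₐ[k] (H ⊗[k] H) ⊗[k] H :=
  Algebra.TensorProduct.map Algebra.TensorProduct.includeLeft (AlgHom.id k H)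

/-- `R ↦ R₂₃ = ∑ 1 ⊗ R⁽¹⁾ ⊗ R⁽²⁾`. -/
noncomputable def leg23 : H ⊗[k] H →ₐ[k] (H ⊗[k] H) ⊗[k] H :=
  Algebra.TensorProduct.map Algebra.TensorProduct.includeRight (AlgHom.id k H)

/-- `R` is a universal R-matrix of (a quasitriangular structure on) the Hopf algebra `H`. -/
structure IsUniversalRMatrix (R : H ⊗[k] H) : Prop where
  isUnit : IsUnit R
  /-- `(Δ ⊗ id)(R) = R₁₃ R₂₃` -/
  comul_left : (Coalgebra.comul (R := k) (A := H)).rTensor H R = leg13 k H R * leg23 k H R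
  /-- `(id ⊗ Δ)(R) = R₁₃ R₁₂` -/
  comul_right : (TensorProduct.assoc k H H H).symm
      ((Coalgebra.comul (R := k) (A := H)).lTensor H R) = leg13 k H R * leg12 k H R
  /-- `Δᵒᵖ(y) R = R Δ(y)` -/
  comul_op : ∀ y : H, TensorProduct.comm k H H (Coalgebra.comul (R := k) y) * R =
      R * Coalgebra.comul (R := k) y

end Quasitriangular

/-! ### The Hopf algebra `k^G #_{σ,τ} k ℤ₂` -/

/-- Data for `k^G #_{σ,τ} k ℤ₂`.  An injective homomorphism `ℤ₂ → Aut(G)` is given by the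
automorphism `act : g ↦ g ◁ x` of order two, `x` being the generator of `ℤ₂`. -/
structure AbExtData (k G : Type*) [Field k] [CommGroup G] where
  act : G ≃* G
  act_act : ∀ g, act (act g) = g
  act_ne : ∃ g, act g ≠ g
  σ : G → kˣ
  τ : G → G → kˣ
  σ_act : ∀ g, σ (act g) = σ g
  σ_one : σ 1 = 1
  τ_one_left : ∀ g, τ 1 g = 1
  τ_one_right : ∀ g, τ g 1 = 1
  /-- `τ` is a 2-cocycle -/
  τ_cocycle : ∀ g h l, τ g h * τ (g * h) l = τ h l * τ g (h * l)
  σ_mul : ∀ g h, σ (g * h) * (σ g)⁻¹ * (σ h)⁻¹ = τ g h * τ (act g) (act h)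

/-- The vector space underlying `k^G #_{σ,τ} k ℤ₂`: the pair `(c, d)` of functions stands for
`∑ g, c g • e_g + ∑ g, d g • e_g x`. -/
def AbExt {k G : Type*} [Field k] [CommGroup G] (_D : AbExtData k G) : Type _ :=
  (G → k) × (G → k)

namespace AbExt

section Basic

variable {k G : Type*} [Field k] [CommGroup G] {D : AbExtData k G}

instance : AddCommGroup (AbExt D) := inferInstanceAs (AddCommGroup ((G → k) × (G → k)))
instance : Module k (AbExt D) := inferInstanceAs (Module k ((G → k) × (G → k)))

@[ext] theorem ext {y z : AbExt D} (h1 : ∀ g, y.1 g = z.1 g) (h2 : ∀ g, y.2 g = z.2 g) :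
    y = z := Prod.ext (funext h1) (funext h2)

@[simp] theorem zero_fst (g : G) : (0 : AbExt D).1 g = 0 := rfl
@[simp] theorem zero_snd (g : G) : (0 : AbExt D).2 g = 0 := rfl
@[simp] theorem add_fst (y z : AbExt D) (g : G) : (y + z).1 g = y.1 g + z.1 g := rfl
@[simp] theorem add_snd (y z : AbExt D) (g : G) : (y + z).2 g = y.2 g + z.2 g := rfl
@[simp] theorem smul_fst (c : k) (y : AbExt D) (g : G) : (c • y).1 g = c * y.1 g := rfl
@[simp] theorem smul_snd (c : k) (y : AbExt D) (g : G) : (c • y).2 g = c * y.2 g := rfl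

instance : One (AbExt D) := ⟨(fun _ => 1, fun _ => 0)⟩

/-- The product determined by `e_g e_h = δ_{g,h} e_g`, `x e_g = e_{g ◁ x} x` and
`x² = ∑ g, σ g • e_g`. -/
instance : Mul (AbExt D) :=
  ⟨fun y z => (fun g => y.1 g * z.1 g + y.2 g * z.2 (D.act g) * D.σ g,
    fun g => y.1 g * z.2 g + y.2 g * z.1 (D.act g))⟩

@[simp] theorem one_fst (g : G) : (1 : AbExt D).1 g = 1 := rfl
@[simp] theorem one_snd (g : G) : (1 : AbExt D).2 g = 0 := rfl
@[simp] theorem mul_fst (y z : AbExt D) (g : G) :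
    (y * z).1 g = y.1 g * z.1 g + y.2 g * z.2 (D.act g) * D.σ g := rfl
@[simp] theorem mul_snd (y z : AbExt D) (g : G) :
    (y * z).2 g = y.1 g * z.2 g + y.2 g * z.1 (D.act g) := rfl

instance : Ring (AbExt D) where
  __ := (inferInstance : AddCommGroup (AbExt D))
  left_distrib y z w := by ext g <;> simp <;> ring
  right_distrib y z w := by ext g <;> simp <;> ring
  zero_mul y := by ext g <;> simp
  mul_zero y := by ext g <;> simp
  mul_assoc y z w := by
    ext g <;> simp [D.act_act, D.σ_act] <;> ring
  one_mul y := by ext g <;> simp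
  mul_one y := by ext g <;> simp

instance : Algebra k (AbExt D) :=
  Algebra.ofModule (fun c y z => by ext g <;> simp <;> ring)
    (fun c y z => by ext g <;> simp <;> ring)

theorem act_eq_iff (g h : G) : D.act g = h ↔ g = D.act h :=
  ⟨fun H => by rw [← H, D.act_act], fun H => by rw [H, D.act_act]⟩

theorem sum_fst {ι : Type*} (s : Finset ι) (f : ι → AbExt D) (g : G) :
    (∑ i ∈ s, f i).1 g = ∑ i ∈ s, (f i).1 g := by
  classical
  induction s using Finset.induction_on with
  | empty => simp
  | insert a s ha ih => simp [Finset.sum_insert ha, ih]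

theorem sum_snd {ι : Type*} (s : Finset ι) (f : ι → AbExt D) (g : G) :
    (∑ i ∈ s, f i).2 g = ∑ i ∈ s, (f i).2 g := by
  classical
  induction s using Finset.induction_on with
  | empty => simp
  | insert a s ha ih => simp [Finset.sum_insert ha, ih]

theorem σ_mul' (g h : G) : (D.σ g : k) * D.σ h * (D.τ g h * D.τ (D.act g) (D.act h)) =
    D.σ (g * h) := by
  have := D.σ_mul g h
  rw [← Units.val_mul, ← Units.val_mul, ← Units.val_mul, ← this]
  congr 1
  rw [mul_assoc, mul_assoc, mul_comm (D.σ g), mul_assoc, mul_comm (D.σ (g * h))]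
  simp [mul_assoc, mul_comm]

theorem τ_inv_comm (g : G) : D.τ g g⁻¹ = D.τ g⁻¹ g := by
  simpa [D.τ_one_left, D.τ_one_right] using D.τ_cocycle g g⁻¹ g

variable [DecidableEq G]

variable (D) in
/-- The basis element `e_g`. -/
def e (g : G) : AbExt D := (Pi.single g 1, 0)

variable (D) in
/-- The basis element `e_g x`. -/
def ex (g : G) : AbExt D := (0, Pi.single g 1)

@[simp] theorem e_fst (g h : G) : (e D g).1 h = if h = g then 1 else 0 := by
  simp [e, Pi.single_apply]
@[simp] theorem e_snd (g h : G) : (e D g).2 h = 0 := rfl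
@[simp] theorem ex_fst (g h : G) : (ex D g).1 h = 0 := rfl
@[simp] theorem ex_snd (g h : G) : (ex D g).2 h = if h = g then 1 else 0 := by
  simp [ex, Pi.single_apply]

theorem e_mul_e (g h : G) : e D g * e D h = if g = h then e D g else 0 := by
  ext i
  · by_cases H : g = h
    · subst H; simp
    · by_cases H1 : i = g
      · subst H1; simp [H]
      · simp [H1, H]
  · by_cases H : g = h <;> simp [H]

theorem e_mul_ex (g h : G) : e D g * ex D h = if g = h then ex D g else 0 := by
  ext i
  · by_cases H : g = h <;> simp [H]
  · by_cases H : g = h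
    · subst H; simp
    · by_cases H1 : i = g
      · subst H1; simp [H]
      · simp [H1, H]

theorem ex_mul_e (g h : G) : ex D g * e D h = if g = D.act h then ex D g else 0 := by
  ext i
  · by_cases H : g = D.act h <;> simp [H]
  · by_cases H : g = D.act h
    · subst H; by_cases H1 : i = D.act h <;> simp [H1, D.act_act]
    · by_cases H1 : i = g
      · subst H1; simp [H, act_eq_iff]
      · simp [H1, H]

theorem ex_mul_ex (g h : G) :
    ex D g * ex D h = if g = D.act h then (D.σ g : k) • e D g else 0 := by
  ext i
  · by_cases H : g = D.act h
    · subst H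
      by_cases H1 : i = D.act h <;> simp [H1, D.act_act]
    · by_cases H1 : i = g
      · subst H1; simp [H, act_eq_iff]
      · simp [H1, H]
  · by_cases H : g = D.act h <;> simp [H]

theorem ex_mul_e' (g h : G) : ex D g * e D h = if h = D.act g then ex D g else 0 := by
  rw [ex_mul_e]
  refine if_congr ?_ rfl rfl
  rw [← act_eq_iff, eq_comm]

theorem ex_mul_ex' (g h : G) :
    ex D g * ex D h = if h = D.act g then (D.σ g : k) • e D g else 0 := by
  rw [ex_mul_ex]
  refine if_congr ?_ rfl rfl
  rw [← act_eq_iff, eq_comm]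

variable (D) in
/-- `ε(e_g) = δ_{g,1} = ε(e_g x)`. -/
def counitMap : AbExt D →ₗ[k] k where
  toFun y := y.1 1 + y.2 1
  map_add' y z := by simp; ring
  map_smul' c y := by simp; ring

theorem counitMap_e (g : G) : counitMap D (e D g) = if g = 1 then 1 else 0 := by
  simp [counitMap, eq_comm]

theorem counitMap_ex (g : G) : counitMap D (ex D g) = if g = 1 then 1 else 0 := by
  simp [counitMap, eq_comm]

end Basic

section Hopf

variable {k G : Type*} [Field k] [CommGroup G] [Fintype G] [DecidableEq G] {D : AbExtData k G}

theorem eq_sum (y : AbExt D) : y = ∑ g, (y.1 g • e D g + y.2 g • ex D g) := by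
  ext h <;> simp [sum_fst, sum_snd]

theorem one_eq_sum : (1 : AbExt D) = ∑ g, e D g := by
  ext h <;> simp [sum_fst, sum_snd]

theorem linearMap_ext {M : Type*} [AddCommMonoid M] [Module k M] {f f' : AbExt D →ₗ[k] M}
    (h1 : ∀ g, f (e D g) = f' (e D g)) (h2 : ∀ g, f (ex D g) = f' (ex D g)) : f = f' := by
  ext y
  rw [eq_sum y]
  simp [h1, h2]

variable (D) in
/-- `Δ(e_g) = ∑_{hj = g} e_h ⊗ e_j` and `Δ(e_g x) = ∑_{hj = g} τ(h,j) e_h x ⊗ e_j x`. -/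
noncomputable def comulMap : AbExt D →ₗ[k] AbExt D ⊗[k] AbExt D where
  toFun y := ∑ h, ∑ j, (y.1 (h * j) • (e D h ⊗ₜ[k] e D j) +
    (y.2 (h * j) * (D.τ h j : k)) • (ex D h ⊗ₜ[k] ex D j))
  map_add' y z := by
    simp only [← Finset.sum_add_distrib]
    refine Finset.sum_congr rfl fun h _ => Finset.sum_congr rfl fun j _ => ?_
    simp only [add_fst, add_snd]
    module
  map_smul' c y := by
    simp only [Finset.smul_sum, RingHom.id_apply]
    refine Finset.sum_congr rfl fun h _ => Finset.sum_congr rfl fun j _ => ?_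
    simp only [smul_fst, smul_snd]
    module

variable (D) in
/-- `S(e_g) = e_{g⁻¹}` and `S(e_g x) = S(x) S(e_g)` with
`S(x) = ∑ g, σ(g)⁻¹ τ(g,g⁻¹)⁻¹ e_{g ◁ x} x`. -/
noncomputable def antipodeMap : AbExt D →ₗ[k] AbExt D where
  toFun y := ∑ g, y.1 g • e D g⁻¹ +
    (∑ g, (((D.σ g)⁻¹ * (D.τ g g⁻¹)⁻¹ : kˣ) : k) • ex D (D.act g)) *
      ∑ g, y.2 g • e D g⁻¹
  map_add' y z := by
    simp only [add_fst, add_snd, add_smul, Finset.sum_add_distrib, mul_add]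
    abel
  map_smul' c y := by
    simp only [smul_fst, smul_snd, RingHom.id_apply, smul_add, mul_smul, ← Finset.smul_sum,
      mul_smul_comm]

theorem comulMap_e (g : G) : comulMap D (e D g) = ∑ h, e D h ⊗ₜ[k] e D (h⁻¹ * g) := by
  have (h j : G) : h * j = g ↔ j = h⁻¹ * g := by rw [eq_inv_mul_iff_mul_eq]
  simp [comulMap, this]

theorem comulMap_ex (g : G) : comulMap D (ex D g) =
    ∑ h, (D.τ h (h⁻¹ * g) : k) • (ex D h ⊗ₜ[k] ex D (h⁻¹ * g)) := by
  have (h j : G) : h * j = g ↔ j = h⁻¹ * g := by rw [eq_inv_mul_iff_mul_eq]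
  simp [comulMap, this]

theorem antipodeMap_e (g : G) : antipodeMap D (e D g) = e D g⁻¹ := by
  simp [antipodeMap]

theorem antipodeMap_ex (g : G) : antipodeMap D (ex D g) =
    (((D.σ g⁻¹)⁻¹ * (D.τ g⁻¹ g)⁻¹ : kˣ) : k) • ex D (D.act g⁻¹) := by
  have (h : G) : D.act h = D.act g⁻¹ ↔ h = g⁻¹ := D.act.injective.eq_iff
  simp only [antipodeMap, LinearMap.coe_mk, AddHom.coe_mk, ex_fst, ex_snd, zero_smul,
    Finset.sum_const_zero, zero_add, ite_smul, one_smul, Finset.sum_ite_eq', Finset.mem_univ,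
    if_true, Finset.sum_mul, smul_mul_assoc, ex_mul_e, this, smul_ite, smul_zero, inv_inv]

theorem comulMap_coassoc : (TensorProduct.assoc k (AbExt D) (AbExt D) (AbExt D)).toLinearMap ∘ₗ
    (comulMap D).rTensor (AbExt D) ∘ₗ comulMap D =
      (comulMap D).lTensor (AbExt D) ∘ₗ comulMap D := by
  apply linearMap_ext <;> intro g
  · simp only [LinearMap.comp_apply, comulMap_e, map_sum, LinearMap.rTensor_tmul,
      LinearMap.lTensor_tmul, TensorProduct.sum_tmul, TensorProduct.tmul_sum,
      LinearEquiv.coe_coe, TensorProduct.assoc_tmul]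
    rw [Finset.sum_comm]
    refine Finset.sum_congr rfl fun i _ => ?_
    rw [← Equiv.sum_comp (Equiv.mulLeft i)]
    refine Finset.sum_congr rfl fun m _ => ?_
    simp [mul_assoc]
  · simp only [LinearMap.comp_apply, comulMap_ex, map_sum, map_smul, LinearMap.rTensor_tmul,
      LinearMap.lTensor_tmul, TensorProduct.sum_tmul, TensorProduct.tmul_sum,
      TensorProduct.tmul_smul, ← TensorProduct.smul_tmul',
      LinearEquiv.coe_coe, TensorProduct.assoc_tmul, Finset.smul_sum, smul_smul]
    rw [Finset.sum_comm]
    refine Finset.sum_congr rfl fun i _ => ?_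
    rw [← Equiv.sum_comp (Equiv.mulLeft i)]
    refine Finset.sum_congr rfl fun m _ => ?_
    have := D.τ_cocycle i m (m⁻¹ * (i⁻¹ * g))
    simp only [mul_inv_cancel_left] at this
    have := congrArg (Units.val) this
    simp only [Units.val_mul] at this
    simp only [Equiv.coe_mulLeft, mul_inv_rev, mul_assoc, inv_mul_cancel_left]
    congr 1
    rw [mul_comm, this, mul_comm]

noncomputable instance : Coalgebra k (AbExt D) where
  comul := comulMap D
  counit := counitMap D
  coassoc := comulMap_coassoc
  rTensor_counit_comp_comul := by
    apply linearMap_ext <;> intro g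
    · simp [comulMap_e, counitMap_e, TensorProduct.ite_tmul]
    · simp [comulMap_ex, counitMap_ex, TensorProduct.ite_tmul, D.τ_one_left]
  lTensor_counit_comp_comul := by
    have (h g : G) : h⁻¹ * g = 1 ↔ h = g := inv_mul_eq_one
    apply linearMap_ext <;> intro g
    · simp [comulMap_e, counitMap_e, TensorProduct.tmul_ite, this]
    · simp [comulMap_ex, counitMap_ex, TensorProduct.tmul_ite, D.τ_one_right, this]

theorem comul_eq (y : AbExt D) : Coalgebra.comul (R := k) y = comulMap D y := rfl

theorem counit_eq (y : AbExt D) : Coalgebra.counit (R := k) y = counitMap D y := rfl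

theorem comulMap_e_mul_e (g j : G) :
    comulMap D (e D g * e D j) = comulMap D (e D g) * comulMap D (e D j) := by
  by_cases H : g = j
  · subst H
    simp [e_mul_e, comulMap_e, Finset.sum_mul_sum, TensorProduct.ite_tmul]
  · simp [e_mul_e, comulMap_e, Finset.sum_mul_sum, TensorProduct.ite_tmul, H]

theorem comulMap_e_mul_ex (g j : G) :
    comulMap D (e D g * ex D j) = comulMap D (e D g) * comulMap D (ex D j) := by
  by_cases H : g = j
  · subst H
    simp [e_mul_ex, comulMap_e, comulMap_ex, Finset.sum_mul_sum, TensorProduct.ite_tmul,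
      mul_smul_comm]
  · simp [e_mul_ex, comulMap_e, comulMap_ex, Finset.sum_mul_sum, TensorProduct.ite_tmul, H,
      mul_smul_comm]

theorem comulMap_ex_mul_e (g j : G) :
    comulMap D (ex D g * e D j) = comulMap D (ex D g) * comulMap D (e D j) := by
  by_cases H : j = D.act g
  · subst H
    simp [ex_mul_e', comulMap_e, comulMap_ex, Finset.sum_mul_sum, TensorProduct.ite_tmul,
      smul_mul_assoc]
  · simp [ex_mul_e', comulMap_e, comulMap_ex, Finset.sum_mul_sum, TensorProduct.ite_tmul, H,
      smul_mul_assoc]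

theorem comulMap_ex_mul_ex (g j : G) :
    comulMap D (ex D g * ex D j) = comulMap D (ex D g) * comulMap D (ex D j) := by
  by_cases H : j = D.act g
  · subst H
    simp only [ex_mul_ex', comulMap_e, comulMap_ex, Finset.sum_mul_sum, TensorProduct.ite_tmul,
      smul_mul_assoc, mul_smul_comm, if_true, map_smul, Finset.smul_sum,
      Algebra.TensorProduct.tmul_mul_tmul, smul_ite, smul_zero,
      Finset.sum_ite_eq', Finset.mem_univ, map_mul, map_inv]
    refine Finset.sum_congr rfl fun h _ => ?_
    have := σ_mul' (D := D) h (h⁻¹ * g)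
    simp only [mul_inv_cancel_left, map_mul, map_inv] at this
    rw [← this]
    simp only [← TensorProduct.smul_tmul', TensorProduct.tmul_smul, smul_smul]
    congr 1
    ring
  · simp [ex_mul_ex', comulMap_ex, Finset.sum_mul_sum, TensorProduct.ite_tmul, H,
      smul_mul_assoc, mul_smul_comm]

noncomputable instance : Bialgebra k (AbExt D) where
  counit_one := by simp [counit_eq, counitMap]
  mul_compr₂_counit := by
    apply linearMap_ext <;> intro g <;> apply linearMap_ext <;> intro h
    · by_cases H : g = h
      · simp [counit_eq, counitMap_e, e_mul_e, H]
      · simp [counit_eq, counitMap_e, e_mul_e, H]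
        rintro rfl; exact H
    · by_cases H : g = h
      · simp [counit_eq, counitMap_e, counitMap_ex, e_mul_ex, H]
      · simp [counit_eq, counitMap_e, counitMap_ex, e_mul_ex, H]
        rintro rfl; exact H
    · by_cases H : h = D.act g
      · simp [counit_eq, counitMap_e, counitMap_ex, ex_mul_e', H]
      · simp [counit_eq, counitMap_e, counitMap_ex, ex_mul_e', H]
        rintro rfl rfl; simp at H
    · by_cases H : h = D.act g
      · by_cases H1 : g = 1
        · simp [counit_eq, counitMap_e, counitMap_ex, ex_mul_ex', H, H1, D.σ_one]
        · simp [counit_eq, counitMap_e, counitMap_ex, ex_mul_ex', H, H1]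
      · simp [counit_eq, counitMap_ex, ex_mul_ex', H]
        rintro rfl rfl; simp at H
  comul_one := by
    rw [comul_eq, one_eq_sum, Algebra.TensorProduct.one_def, one_eq_sum]
    simp only [map_sum, comulMap_e, TensorProduct.sum_tmul, TensorProduct.tmul_sum]
    rw [Finset.sum_comm]
    conv_rhs => rw [Finset.sum_comm]
    refine Finset.sum_congr rfl fun i _ => ?_
    exact Equiv.sum_comp (Equiv.mulLeft i⁻¹) fun j => e D i ⊗ₜ[k] e D j
  mul_compr₂_comul := by
    apply linearMap_ext <;> intro g <;> apply linearMap_ext <;> intro h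
    · exact comulMap_e_mul_e g h
    · exact comulMap_e_mul_ex g h
    · exact comulMap_ex_mul_e g h
    · exact comulMap_ex_mul_ex g h

noncomputable instance : HopfAlgebra k (AbExt D) where
  antipode := antipodeMap D
  mul_antipode_rTensor_comul := by
    apply linearMap_ext <;> intro g
    · have (h : G) : h⁻¹ = h⁻¹ * g ↔ g = 1 := by simp
      by_cases H : g = 1
      · simp [comul_eq, counit_eq, comulMap_e, antipodeMap_e, e_mul_e, counitMap_e, H, one_eq_sum]
        exact Equiv.sum_comp (Equiv.inv G) (e D)
      · simp [comul_eq, counit_eq, comulMap_e, antipodeMap_e, e_mul_e, counitMap_e, H]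
    · by_cases H : g = 1
      · have h2 (i : G) : (D.σ (D.act i)⁻¹ : k) = D.σ i⁻¹ := by rw [← map_inv, D.σ_act]
        simp [comul_eq, counit_eq, comulMap_ex, antipodeMap_ex, ex_mul_ex', counitMap_ex, H,
          one_eq_sum, smul_smul, τ_inv_comm, h2, mul_left_comm, mul_assoc, D.act_act]
        rw [← Equiv.sum_comp ((Equiv.inv G).trans D.act.toEquiv) (e D)]
        simp
      · simp [comul_eq, counit_eq, comulMap_ex, antipodeMap_ex, ex_mul_ex', counitMap_ex, H,
          D.act_act]
  mul_antipode_lTensor_comul := by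
    apply linearMap_ext <;> intro g
    · have (h : G) : h = g⁻¹ * h ↔ g = 1 := by simp
      by_cases H : g = 1
      · simp [comul_eq, counit_eq, comulMap_e, antipodeMap_e, e_mul_e, counitMap_e, H, one_eq_sum]
      · simp [comul_eq, counit_eq, comulMap_e, antipodeMap_e, e_mul_e, counitMap_e, H]
    · by_cases H : g = 1
      · simp [comul_eq, counit_eq, comulMap_ex, antipodeMap_ex, ex_mul_ex', counitMap_ex, H,
          one_eq_sum, smul_smul, τ_inv_comm, mul_left_comm]
      · simp [comul_eq, counit_eq, comulMap_ex, antipodeMap_ex, ex_mul_ex', counitMap_ex, H]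

variable (D) in
/-- `S = {g | g ◁ x = g}`. -/
def fixedSet : Finset G := Finset.univ.filter fun g => D.act g = g

variable (D) in
/-- `T = {g | g ◁ x ≠ g}`. -/
def movedSet : Finset G := Finset.univ.filter fun g => D.act g ≠ g

variable (D) in
/-- A trivial quasitriangular structure: a universal R-matrix of the form
`∑ w(g,h) e_g ⊗ e_h`. -/
def IsTrivialStructure (R : AbExt D ⊗[k] AbExt D) : Prop :=
  IsUniversalRMatrix k (AbExt D) R ∧
    ∃ w : G → G → k, R = ∑ g, ∑ h, w g h • (e D g ⊗ₜ[k] e D h)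

variable (D) in
/-- A non-trivial quasitriangular structure: a universal R-matrix of the form
`∑_{S×S} w¹(s₁,s₂) e_{s₁} ⊗ e_{s₂} + ∑_{S×T} w²(s,t) e_s x ⊗ e_t
  + ∑_{T×S} w³(t,s) e_t ⊗ e_s x + ∑_{T×T} w⁴(t₁,t₂) e_{t₁} x ⊗ e_{t₂} x`. -/
def IsNontrivialStructure (R : AbExt D ⊗[k] AbExt D) : Prop :=
  IsUniversalRMatrix k (AbExt D) R ∧
    ∃ w1 w2 w3 w4 : G → G → k, R =
      (∑ s₁ ∈ fixedSet D, ∑ s₂ ∈ fixedSet D, w1 s₁ s₂ • (e D s₁ ⊗ₜ[k] e D s₂)) +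
      (∑ s ∈ fixedSet D, ∑ t ∈ movedSet D, w2 s t • (ex D s ⊗ₜ[k] e D t)) +
      (∑ t ∈ movedSet D, ∑ s ∈ fixedSet D, w3 t s • (e D t ⊗ₜ[k] ex D s)) +
      (∑ t₁ ∈ movedSet D, ∑ t₂ ∈ movedSet D, w4 t₁ t₂ • (ex D t₁ ⊗ₜ[k] ex D t₂))

end Hopf

end AbExt

/-! ### The Hopf algebras `K(8n, σ, τ)` -/

/-- `G = ℤ_{2n} × ℤ₂ = ⟨a, b | a^{2n} = b² = 1, ab = ba⟩`. -/
abbrev KGroup (n : ℕ) : Type := Multiplicative (ZMod (2 * n)) × Multiplicative (ZMod 2)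

namespace KGroup

/-- The generator `a` of order `2n`. -/
def a (n : ℕ) : KGroup n := (Multiplicative.ofAdd 1, 1)

/-- The generator `b` of order `2`. -/
def b (n : ℕ) : KGroup n := (1, Multiplicative.ofAdd 1)

end KGroup

/-- The data `(G, ◁, σ, τ)` is that of a Hopf algebra `K(8n, σ, τ)`:
`a ◁ x = ab` and `b ◁ x = b`. -/
structure IsKData {k : Type*} [Field k] {n : ℕ} (D : AbExtData k (KGroup n)) : Prop where
  act_a : D.act (KGroup.a n) = KGroup.a n * KGroup.b n
  act_b : D.act (KGroup.b n) = KGroup.b n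

namespace KAlg

open KGroup AbExt

variable {k : Type*} [Field k] {n : ℕ} (D : AbExtData k (KGroup n))

/-- `η(g,h) = τ(g,h) τ(h,g)⁻¹`. -/
def eta (g h : KGroup n) : k := D.τ g h * (D.τ h g : k)⁻¹

/-- `P_i = ∏_{m=1}^{i-1} τ(a,a^m)`, and `P_0 = P_1 = 1`. -/
def P (i : ℕ) : k := ∏ m ∈ Finset.Ico 1 i, (D.τ (a n) (a n ^ m) : k)

/-- `λ_{2i,j} = P_{2i}⁻¹ σ(a^j)^i` and `λ_{2i+1,j} = P_{2i+1}⁻¹ σ(a^j)^i`. -/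
def lam (i j : ℕ) : k := (P D i)⁻¹ * (D.σ (a n ^ j) : k) ^ (i / 2)

/-- `h(t₁,t₂) = τ(t₁,t₂) / τ(t₂ ◁ x, t₁ ◁ x)`. -/
def hFun (t₁ t₂ : KGroup n) : k := D.τ t₁ t₂ / D.τ (D.act t₂) (D.act t₁)

/-- `S_{j,0} = λ_{2j+1,1} α^{j+1} β^j`. -/
def S0 (α β : k) (j : ℕ) : k := lam D (2 * j + 1) 1 * α ^ (j + 1) * β ^ j

/-- `S_{j,1} = h(a, a^{2j+1}b) λ_{2j+1,1} α^j β^{j+1}`. -/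
def S1 (α β : k) (j : ℕ) : k :=
  hFun D (a n) (a n ^ (2 * j + 1) * b n) * lam D (2 * j + 1) 1 * α ^ j * β ^ (j + 1)

/-- `w¹(a^{2i}b^p, a^{2j}b^q)`, the same for all `p, q`. -/
def w1 (α β : k) (i j : ℕ) : k :=
  lam D (2 * j) 1 ^ (2 * i) * (α * β) ^ (2 * i * j) * (D.σ (a n ^ (2 * j)) : k) ^ i

/-- `w²(a^{2i}b^p, a^{2j+1}b^q)`, the same for all `q`. -/
def w2 (α β : k) (i : ℕ) (p : Fin 2) (j : ℕ) : k :=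
  match p with
  | 0 => lam D (2 * i) (2 * j + 1) * (S0 D α β j * S1 D α β j) ^ i
  | 1 => (D.τ (b n) (a n) * β) / (D.τ (b n) (a n ^ (2 * i)) * α) *
      lam D (2 * i) (2 * j + 1) * (S0 D α β j * S1 D α β j) ^ i

/-- `w³(a^{2i+1}b^p, a^{2j}b^q)`, the same for all `p`. -/
def w3 (α β : k) (i j : ℕ) (q : Fin 2) : k :=
  match q with
  | 0 => lam D (2 * j) (2 * i + 1) * (S0 D α β i * S1 D α β i) ^ j
  | 1 => (D.τ (b n) (a n) * β) / (D.τ (b n) (a n ^ (2 * j)) * α) *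
      lam D (2 * j) (2 * i + 1) * (S0 D α β i * S1 D α β i) ^ j

/-- `w⁴(a^{2i+1}b^p, a^{2j+1}b^q)`. -/
def w4 (α β : k) (i : ℕ) (p : Fin 2) (j : ℕ) (q : Fin 2) : k :=
  match p, q with
  | 0, 0 => lam D (2 * i + 1) (2 * j + 1) * S0 D α β j ^ (i + 1) * S1 D α β j ^ i
  | 0, 1 => lam D (2 * i + 1) (2 * j + 1) * S0 D α β j ^ i * S1 D α β j ^ (i + 1)
  | 1, 0 => hFun D (a n ^ (2 * i + 1) * b n) (a n ^ (2 * j + 1)) *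
      lam D (2 * i + 1) (2 * j + 1) * S0 D α β j ^ i * S1 D α β j ^ (i + 1)
  | 1, 1 => hFun D (a n ^ (2 * i + 1) * b n) (a n ^ (2 * j + 1) * b n) *
      lam D (2 * i + 1) (2 * j + 1) * S0 D α β j ^ (i + 1) * S1 D α β j ^ i

/-- The element `R'_{α,β}`; here `S = {a^{2i}b^p}` and `T = {a^{2i+1}b^p}` with
`0 ≤ i < n` and `p ∈ {0, 1}`. -/
noncomputable def RPrime (α β : k) : AbExt D ⊗[k] AbExt D :=
  ∑ i ∈ Finset.range n, ∑ p : Fin 2, ∑ j ∈ Finset.range n, ∑ q : Fin 2,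
    (w1 D α β i j •
        (e D (a n ^ (2 * i) * b n ^ (p : ℕ)) ⊗ₜ[k] e D (a n ^ (2 * j) * b n ^ (q : ℕ))) +
      w2 D α β i p j •
        (ex D (a n ^ (2 * i) * b n ^ (p : ℕ)) ⊗ₜ[k] e D (a n ^ (2 * j + 1) * b n ^ (q : ℕ))) +
      w3 D α β i j q •
        (e D (a n ^ (2 * i + 1) * b n ^ (p : ℕ)) ⊗ₜ[k] ex D (a n ^ (2 * j) * b n ^ (q : ℕ))) +
      w4 D α β i p j q •
        (ex D (a n ^ (2 * i + 1) * b n ^ (p : ℕ)) ⊗ₜ[k]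
          ex D (a n ^ (2 * j + 1) * b n ^ (q : ℕ))))

/-- `∑ α^{ik} β^{il-jk} e_{a^i b^j} ⊗ e_{a^k b^l}` over `1 ≤ i, k ≤ 2n` and `1 ≤ j, l ≤ 2`. -/
noncomputable def RTrivial (α β : k) : AbExt D ⊗[k] AbExt D :=
  ∑ i ∈ Finset.Icc 1 (2 * n), ∑ j ∈ Finset.Icc 1 2,
    ∑ m ∈ Finset.Icc 1 (2 * n), ∑ l ∈ Finset.Icc 1 2,
      (α ^ (i * m) * β ^ ((i : ℤ) * l - (j : ℤ) * m)) •
        (e D (a n ^ i * b n ^ j) ⊗ₜ[k] e D (a n ^ m * b n ^ l))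

end KAlg

/-! Both shapes of `R` are instances of one: `R = ∑ w(g,h) e_g x^π(h) ⊗ e_h x^π(g)`, where `π : G →
ℤ₂` is zero in the trivial case and the indicator of `T` in the non-trivial case. In both cases `π`
is a homomorphism invariant under `x`, and twisting `g` by `x^π(h)` and `h` by `x^π(g)` does not
change the product `gh`. Comparing coefficients then turns the R-matrix axioms into functional
equations for `w` (`isUniversalRMatrix_rMat_iff`).

The quotient `τ(g,h)/τ(h,g)` is a bicharacter with value `1` on the diagonal, so `η(a,b) = 1` forces
`τ` to be symmetric (`tau_symm`). Since `kˣ` is divisible, `τ` is then a coboundary: `τ(g,h) c(gh) =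
c(g) c(h)` (`exists_tau_eq`).

In the trivial case, symmetry of `τ` reduces the equations to: `w` is an `x`-invariant bicharacter.
It is determined by `w(a,a)` and `w(a,b)`, because invariance gives `w(b,b) = 1` and `w(a,b) w(b,a)
= 1`.

In the non-trivial case, rescaling `e_g x` by `c(g)` removes `τ` and replaces `σ` by the character
`ζ(g) = σ(g) c(g) c(g ◁ x)`, with `ζ(b) = 1` (`isRFunction_moved_iff`). The normalized coefficients
`W` are determined by `u = W(a,a)` and `ε = W(b,a)`, subject to `ε² = 1` and `(ε u² ζ(a))ⁿ = 1`;
conversely every such pair gives a solution (`exists_of_isUntwisted`, `isUntwisted_of_eq`). The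
substitution `α = u c(a)²`, `β = ε u c(a) c(ab)` identifies these solutions with the `R'_{α,β}` and
these constraints with the stated ones (`rMat_eq_rPrime`, `constraints_iff`). -/

namespace AbExt

/-! ### Coefficients of products and coproducts in the basis `e_g x^i` -/

section Coordinates

variable {k G : Type*} [Field k] [CommGroup G] {D : AbExtData k G}

variable (D) in
/-- The action of `x ^ i` on `G`. -/
def tw (i : Bool) (g : G) : G := cond i (D.act g) g

variable (D) in
/-- The linear functional `y ↦` coefficient of `e_g x^i` in `y`. -/
def co (i : Bool) (g : G) : AbExt D →ₗ[k] k where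
  toFun y := cond i (y.2 g) (y.1 g)
  map_add' y z := by cases i <;> simp
  map_smul' c y := by cases i <;> simp

variable (D) in
/-- The scalar `τ(g,h)^i`. -/
def tauPow (i : Bool) (g h : G) : k := cond i (D.τ g h : k) 1

variable (D) in
/-- The scalar `σ(g)^(ij)`. -/
def sigPow (i j : Bool) (g : G) : k := cond (i && j) (D.σ g : k) 1

theorem co_mul (m : Bool) (g : G) (y z : AbExt D) : co D m g (y * z) =
    ∑ i : Bool, co D i g y * co D (xor i m) (tw D i g) z * sigPow D i (xor i m) g := by
  cases m <;> simp [co, tw, sigPow, add_comm]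

theorem co_one (m : Bool) (g : G) : co D m g 1 = cond m 0 1 := by
  cases m <;> simp [co]

variable (D) in
/-- The coefficient of `e_g x^i ⊗ e_h x^j`. -/
noncomputable def coord (i j : Bool) (g h : G) : AbExt D ⊗[k] AbExt D →ₗ[k] k :=
  LinearMap.mul' k k ∘ₗ TensorProduct.map (co D i g) (co D j h)

variable (D) in
/-- The coefficient of `e_g x^i ⊗ e_h x^j ⊗ e_r x^l`. -/
noncomputable def coord3 (i j l : Bool) (g h r : G) :
    (AbExt D ⊗[k] AbExt D) ⊗[k] AbExt D →ₗ[k] k :=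
  LinearMap.mul' k k ∘ₗ TensorProduct.map (coord D i j g h) (co D l r)

@[simp] theorem coord_tmul (i j : Bool) (g h : G) (y z : AbExt D) :
    coord D i j g h (y ⊗ₜ z) = co D i g y * co D j h z := by
  simp [coord]

@[simp] theorem coord3_tmul (i j l : Bool) (g h r : G) (y : AbExt D ⊗[k] AbExt D)
    (z : AbExt D) : coord3 D i j l g h r (y ⊗ₜ z) = coord D i j g h y * co D l r z := by
  simp [coord3]

theorem coord_mul (m m' : Bool) (g h : G) (y z : AbExt D ⊗[k] AbExt D) :
    coord D m m' g h (y * z) = ∑ i : Bool, ∑ j : Bool, coord D i j g h y *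
      coord D (xor i m) (xor j m') (tw D i g) (tw D j h) z *
      (sigPow D i (xor i m) g * sigPow D j (xor j m') h) := by
  induction y with
  | zero => simp
  | add y y' hy hy' =>
    rw [add_mul, map_add, hy, hy', ← Finset.sum_add_distrib]
    simp only [← Finset.sum_add_distrib, map_add, add_mul]
  | tmul y y' =>
    induction z with
    | zero => simp
    | add z z' hz hz' =>
      rw [mul_add, map_add, hz, hz']
      simp only [← Finset.sum_add_distrib, map_add, add_mul, mul_add]
    | tmul z z' =>
      rw [Algebra.TensorProduct.tmul_mul_tmul, coord_tmul, co_mul, co_mul, Finset.sum_mul_sum]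
      refine Finset.sum_congr rfl fun i _ => Finset.sum_congr rfl fun j _ => ?_
      simp only [coord_tmul]
      ring

theorem coord_one (m m' : Bool) (g h : G) :
    coord D m m' g h 1 = cond m 0 (cond m' 0 1) := by
  rw [Algebra.TensorProduct.one_def, coord_tmul, co_one, co_one]
  cases m <;> simp

theorem coord_comm (i j : Bool) (g h : G) (y : AbExt D ⊗[k] AbExt D) :
    coord D i j g h (TensorProduct.comm k _ _ y) = coord D j i h g y := by
  induction y with
  | zero => simp
  | add y y' hy hy' => simp [hy, hy']
  | tmul y y' => simp [mul_comm]

theorem coord3_assoc_symm (i j l : Bool) (g h r : G) (y : AbExt D)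
    (z : AbExt D ⊗[k] AbExt D) :
    coord3 D i j l g h r ((TensorProduct.assoc k _ _ _).symm (y ⊗ₜ z)) =
      co D i g y * coord D j l h r z := by
  induction z with
  | zero => simp
  | add z z' hz hz' => rw [TensorProduct.tmul_add, map_add, map_add, hz, hz', map_add, mul_add]
  | tmul z z' => simp [mul_assoc]

variable [DecidableEq G]

variable (D) in
/-- The basis element `e_g x^i`. -/
def bas (i : Bool) (g : G) : AbExt D := cond i (ex D g) (e D g)

theorem co_bas (i j : Bool) (g h : G) :
    co D i g (bas D j h) = if i = j ∧ g = h then 1 else 0 := by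
  cases i <;> cases j <;> simp [co, bas]

variable [Fintype G]

theorem sum_co_bas (y : AbExt D) : ∑ i, ∑ g, co D i g y • bas D i g = y := by
  conv_rhs => rw [eq_sum y]
  simp [co, bas, Finset.sum_add_distrib, add_comm]

theorem sum_coord_bas (y : AbExt D ⊗[k] AbExt D) :
    ∑ i, ∑ g, ∑ j, ∑ h, coord D i j g h y • (bas D i g ⊗ₜ[k] bas D j h) = y := by
  induction y with
  | zero => simp
  | add y y' hy hy' =>
    conv_rhs => rw [← hy, ← hy']
    simp only [map_add, add_smul, Finset.sum_add_distrib]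
  | tmul y y' =>
    conv_rhs => rw [← sum_co_bas y, ← sum_co_bas y']
    simp only [TensorProduct.sum_tmul]
    simp only [TensorProduct.tmul_sum, coord_tmul, TensorProduct.smul_tmul_smul]

theorem coord_ext {y z : AbExt D ⊗[k] AbExt D}
    (H : ∀ i j g h, coord D i j g h y = coord D i j g h z) : y = z := by
  rw [← sum_coord_bas y, ← sum_coord_bas z]
  simp only [H]

theorem sum_coord3_bas (y : (AbExt D ⊗[k] AbExt D) ⊗[k] AbExt D) :
    ∑ i, ∑ g, ∑ j, ∑ h, ∑ l, ∑ r, coord3 D i j l g h r y •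
      ((bas D i g ⊗ₜ[k] bas D j h) ⊗ₜ[k] bas D l r) = y := by
  induction y with
  | zero => simp
  | add y y' hy hy' =>
    conv_rhs => rw [← hy, ← hy']
    simp only [map_add, add_smul, Finset.sum_add_distrib]
  | tmul y y' =>
    conv_rhs => rw [← sum_coord_bas y, ← sum_co_bas y']
    simp only [TensorProduct.sum_tmul]
    simp only [TensorProduct.tmul_sum, coord3_tmul, TensorProduct.smul_tmul_smul]

theorem coord3_ext {y z : (AbExt D ⊗[k] AbExt D) ⊗[k] AbExt D}
    (H : ∀ i j l g h r, coord3 D i j l g h r y = coord3 D i j l g h r z) : y = z := by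
  rw [← sum_coord3_bas y, ← sum_coord3_bas z]
  simp only [H]

/-- Both legs of `Δ(e_g x^i)` carry the same power of `x`, which kills the mixed coefficients. -/
theorem coord_comul (i j : Bool) (g h : G) (y : AbExt D) :
    coord D i j g h (Coalgebra.comul (R := k) y) =
      if i = j then tauPow D i g h * co D i (g * h) y else 0 := by
  have key (a b : G → AbExt D) (f : G → G → k) :
      coord D i j g h (∑ s, ∑ t, f s t • (a s ⊗ₜ[k] b t)) =
        ∑ s, ∑ t, f s t * (co D i g (a s) * co D j h (b t)) := by simp
  rw [comul_eq]
  simp only [comulMap, LinearMap.coe_mk, AddHom.coe_mk, Finset.sum_add_distrib, map_add, key]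
  cases i <;> cases j <;> simp [co, tauPow, mul_comm]

theorem coord3_comul_left (i j l : Bool) (g h r : G) (y : AbExt D ⊗[k] AbExt D) :
    coord3 D i j l g h r ((Coalgebra.comul (R := k) (A := AbExt D)).rTensor _ y) =
      if i = j then tauPow D i g h * coord D i l (g * h) r y else 0 := by
  induction y with
  | zero => simp
  | add y y' hy hy' => rw [map_add, map_add, hy, hy']; split_ifs <;> simp [mul_add]
  | tmul y y' =>
    rw [LinearMap.rTensor_tmul, coord3_tmul, coord_comul]
    split_ifs <;> simp [mul_assoc]

theorem coord3_comul_right (i j l : Bool) (g h r : G) (y : AbExt D ⊗[k] AbExt D) :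
    coord3 D i j l g h r ((TensorProduct.assoc k _ _ _).symm
      ((Coalgebra.comul (R := k) (A := AbExt D)).lTensor _ y)) =
      if j = l then tauPow D j h r * coord D i j g (h * r) y else 0 := by
  induction y with
  | zero => simp
  | add y y' hy hy' => rw [map_add, map_add, map_add, hy, hy']; split_ifs <;> simp [mul_add]
  | tmul y y' =>
    rw [LinearMap.lTensor_tmul, coord3_assoc_symm, coord_comul]
    split_ifs <;> simp [mul_left_comm]

/-- The two factors meet only in the third leg, so only there do a twist of the index and a factor
`σ` appear. -/
theorem coord3_leg13_mul_leg23 (i j l : Bool) (g h r : G) (y z : AbExt D ⊗[k] AbExt D) :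
    coord3 D i j l g h r (leg13 k _ y * leg23 k _ z) = ∑ m : Bool,
      coord D i m g r y * coord D j (xor m l) h (tw D m r) z * sigPow D m (xor m l) r := by
  induction y with
  | zero => simp
  | add y y' hy hy' => simp only [map_add, add_mul, hy, hy', Finset.sum_add_distrib]
  | tmul y y' =>
    induction z with
    | zero => simp
    | add z z' hz hz' => simp only [map_add, mul_add, add_mul, hz, hz', Finset.sum_add_distrib]
    | tmul z z' =>
      simp only [leg13, leg23, Algebra.TensorProduct.map_tmul, AlgHom.coe_id, id,
        Algebra.TensorProduct.includeLeft_apply, Algebra.TensorProduct.includeRight_apply,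
        Algebra.TensorProduct.tmul_mul_tmul, one_mul, mul_one, coord3_tmul, coord_tmul, co_mul,
        Finset.mul_sum]
      refine Finset.sum_congr rfl fun m _ => ?_
      ring

theorem coord3_leg13_mul_leg12 (i j l : Bool) (g h r : G) (y z : AbExt D ⊗[k] AbExt D) :
    coord3 D i j l g h r (leg13 k _ y * leg12 k _ z) = ∑ m : Bool,
      coord D m l g r y * coord D (xor m i) j (tw D m g) h z * sigPow D m (xor m i) g := by
  induction y with
  | zero => simp
  | add y y' hy hy' => simp only [map_add, add_mul, hy, hy', Finset.sum_add_distrib]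
  | tmul y y' =>
    induction z with
    | zero => simp
    | add z z' hz hz' => simp only [map_add, mul_add, add_mul, hz, hz', Finset.sum_add_distrib]
    | tmul z z' =>
      simp only [leg13, leg12, Algebra.TensorProduct.map_tmul, AlgHom.coe_id, id,
        Algebra.TensorProduct.includeLeft_apply,
        Algebra.TensorProduct.tmul_mul_tmul, one_mul, mul_one, coord3_tmul, coord_tmul, co_mul,
        Finset.sum_mul]
      refine Finset.sum_congr rfl fun m _ => ?_
      ring

end Coordinates

end AbExt

/-! ### The R-matrix axioms as functional equations for the coefficients -/

namespace AbExt

section RMatrix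

variable {k G : Type*} [Field k] [CommGroup G] {D : AbExtData k G}

theorem tw_tw (i : Bool) (g : G) : tw D i (tw D i g) = g := by
  cases i <;> simp [tw, D.act_act]

theorem sigPow_tw (i j l : Bool) (g : G) : sigPow D i j (tw D l g) = sigPow D i j g := by
  cases l <;> simp [tw, sigPow, D.σ_act]

theorem sigPow_comm (i j : Bool) (g : G) : sigPow D i j g = sigPow D j i g := by
  simp [sigPow, Bool.and_comm]

theorem sigPow_ne_zero (i j : Bool) (g : G) : sigPow D i j g ≠ 0 := by
  unfold sigPow; cases i && j <;> simp

variable [Fintype G] [DecidableEq G]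

variable (D) in
/-- The element `∑ w(g,h) e_g x^π(h) ⊗ e_h x^π(g)`. -/
noncomputable def rMat (π : G → Bool) (w : G → G → k) : AbExt D ⊗[k] AbExt D :=
  ∑ g, ∑ h, w g h • (bas D (π h) g ⊗ₜ[k] bas D (π g) h)

theorem coord_rMat (π : G → Bool) (w : G → G → k) (i j : Bool) (g h : G) :
    coord D i j g h (rMat D π w) = if i = π h ∧ j = π g then w g h else 0 := by
  simp only [rMat, map_sum, map_smul, coord_tmul, co_bas, smul_eq_mul, ← ite_and, mul_ite,
    mul_one, mul_zero]
  rw [Finset.sum_eq_single g, Finset.sum_eq_single h]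
  · refine if_congr ?_ rfl rfl
    tauto
  · intro s _ hs
    rw [if_neg]
    tauto
  · simp
  · intro s _ hs
    refine Finset.sum_eq_zero fun t _ => ?_
    rw [if_neg]
    tauto
  · simp

/-- For given `g, h` only one pair of powers of `x` occurs in `R`, so a single term of `coord_mul`
survives. -/
theorem coord_rMat_mul (π : G → Bool) (w : G → G → k) (m m' : Bool) (g h : G)
    (z : AbExt D ⊗[k] AbExt D) :
    coord D m m' g h (rMat D π w * z) = w g h *
      coord D (xor (π h) m) (xor (π g) m') (tw D (π h) g) (tw D (π g) h) z *
      (sigPow D (π h) (xor (π h) m) g * sigPow D (π g) (xor (π g) m') h) := by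
  simp only [coord_mul, coord_rMat]
  cases π h <;> cases π g <;> simp

theorem coord_mul_rMat {π : G → Bool} (hact : ∀ g, π (D.act g) = π g) (w : G → G → k)
    (m m' : Bool) (g h : G) (z : AbExt D ⊗[k] AbExt D) :
    coord D m m' g h (z * rMat D π w) = coord D (xor (π h) m) (xor (π g) m') g h z *
      w (tw D (xor (π h) m) g) (tw D (xor (π g) m') h) *
      (sigPow D (xor (π h) m) (π h) g * sigPow D (xor (π g) m') (π g) h) := by
  have ht (i : Bool) (g : G) : π (tw D i g) = π g := by cases i <;> simp [tw, hact]
  simp only [coord_mul, coord_rMat, ht]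
  cases π h <;> cases π g <;> cases m <;> cases m' <;> simp

/-- A zero of `w` at `(g,h)` makes the `e_g ⊗ e_h` coefficient of every `R z` vanish, while that of
`1` is `1`. Otherwise an inverse of the same shape can be written down. -/
theorem isUnit_rMat_iff {π : G → Bool} (hact : ∀ g, π (D.act g) = π g) (w : G → G → k) :
    IsUnit (rMat D π w) ↔ ∀ g h, w g h ≠ 0 := by
  have ht (i : Bool) (g : G) : π (tw D i g) = π g := by cases i <;> simp [tw, hact]
  constructor
  · intro H g h hw
    obtain ⟨z, hz⟩ := H.exists_right_inv
    have := congrArg (coord D false false g h) hz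
    rw [coord_rMat_mul, coord_one, hw] at this
    simp at this
  · intro H
    -- The term of `R` at `(g,h)` multiplies to a nonzero value only with the term at the twisted
    -- pair, and the product carries the `σ` factors; the weight cancels both.
    let w' : G → G → k := fun g h => (w (tw D (π h) g) (tw D (π g) h) *
      (sigPow D (π h) (π h) g * sigPow D (π g) (π g) h))⁻¹
    have h1 : rMat D π w * rMat D π w' = 1 := by
      refine coord_ext fun i j g h => ?_
      rw [coord_rMat_mul, coord_rMat, coord_one]
      simp only [w', ht, tw_tw, sigPow_tw]
      have := H g h
      have := sigPow_ne_zero (D := D) (π h) (π h) g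
      have := sigPow_ne_zero (D := D) (π g) (π g) h
      cases i <;> cases j <;> simp
      field_simp
    have h2 : rMat D π w' * rMat D π w = 1 := by
      refine coord_ext fun i j g h => ?_
      rw [coord_rMat_mul, coord_rMat, coord_one]
      simp only [w', ht]
      have := H (tw D (π h) g) (tw D (π g) h)
      have := sigPow_ne_zero (D := D) (π h) (π h) g
      have := sigPow_ne_zero (D := D) (π g) (π g) h
      cases i <;> cases j <;> simp
      field_simp
    exact ⟨⟨_, _, h1, h2⟩, rfl⟩

variable (D) in
/-- The conditions on the coefficients `w` for `rMat D π w` to be a universal R-matrix. -/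
structure IsRFunction (π : G → Bool) (w : G → G → k) : Prop where
  ne_zero : ∀ g h, w g h ≠ 0
  mul_left : ∀ g g' h, tauPow D (π h) g g' * w (g * g') h =
    w g h * w g' (tw D (π g) h) * sigPow D (π g) (π g') h
  mul_right : ∀ g g' h, tauPow D (π h) g g' * w h (g * g') =
    w h g' * w (tw D (π g') h) g * sigPow D (π g) (π g') h
  act : ∀ g h, D.τ h g * w (D.act g) (D.act h) =
    w g h * D.τ (tw D (π h) g) (tw D (π g) h)

/-- Each axiom is compared coefficient by coefficient. Multiplicativity of `π` makes the powers of
`x` match in the two coproduct axioms, and `htw` makes both sides of the last axiom read off the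
same coefficient of `y`, the one at `gh`. -/
theorem isUniversalRMatrix_rMat_iff {π : G → Bool} (hact : ∀ g, π (D.act g) = π g)
    (hmul : ∀ g h, π (g * h) = xor (π g) (π h))
    (htw : ∀ g h, tw D (π h) g * tw D (π g) h = g * h) (w : G → G → k) :
    IsUniversalRMatrix k (AbExt D) (rMat D π w) ↔ IsRFunction D π w := by
  have ht (i : Bool) (g : G) : π (tw D i g) = π g := by cases i <;> simp [tw, hact]
  have hop (m m' : Bool) (g h : G) (y : AbExt D) :
      coord D m m' g h (TensorProduct.comm k _ _ (Coalgebra.comul (R := k) y) * rMat D π w) =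
        (if xor (π g) m' = xor (π h) m then tauPow D (xor (π g) m') h g *
          co D (xor (π g) m') (g * h) y else 0) *
          w (tw D (xor (π h) m) g) (tw D (xor (π g) m') h) *
          (sigPow D (xor (π h) m) (π h) g * sigPow D (xor (π g) m') (π g) h) := by
    rw [coord_mul_rMat hact, coord_comm, coord_comul, mul_comm h g]
  have hco (m m' : Bool) (g h : G) (y : AbExt D) :
      coord D m m' g h (rMat D π w * Coalgebra.comul (R := k) y) = w g h *
        (if xor (π h) m = xor (π g) m' then
          tauPow D (xor (π h) m) (tw D (π h) g) (tw D (π g) h) *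
          co D (xor (π h) m) (g * h) y else 0) *
        (sigPow D (π h) (xor (π h) m) g * sigPow D (π g) (xor (π g) m') h) := by
    rw [coord_rMat_mul, coord_comul, htw]
  constructor
  · intro H
    refine ⟨(isUnit_rMat_iff hact w).1 H.isUnit, fun g g' h => ?_, fun g g' h => ?_,
      fun g h => ?_⟩
    -- These powers of `x` are the only ones at which the two sides can be nonzero.
    · have := congrArg (coord3 D (π h) (π h) (xor (π g) (π g')) g g' h) H.comul_left
      simp only [coord3_comul_left, coord3_leg13_mul_leg23, coord_rMat, ht, hmul] at this
      revert this
      cases π g <;> cases π g' <;> simp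
    · have := congrArg (coord3 D (xor (π g) (π g')) (π h) (π h) h g g') H.comul_right
      simp only [coord3_comul_right, coord3_leg13_mul_leg12, coord_rMat, ht, hmul] at this
      revert this
      cases π g <;> cases π g' <;> simp [sigPow]
    -- Elements `e_g` give no condition, so the test element is `e_{gh} x`; its extra `x` in both
    -- legs flips both exponents.
    · have := congrArg (coord D (!(π h)) (!(π g)) g h) (H.comul_op (bas D true (g * h)))
      rw [hop, hco] at this
      have h1 := sigPow_ne_zero (D := D) true (π h) g
      have h2 := sigPow_ne_zero (D := D) true (π g) h
      rw [sigPow_comm] at h1 h2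
      simp only [Bool.bne_not_self, co_bas] at this
      simpa [sigPow_comm true, h1, h2, tauPow, tw] using this
  · intro H
    refine ⟨(isUnit_rMat_iff hact w).2 H.ne_zero, coord3_ext fun i j l g g' h => ?_,
      coord3_ext fun i j l h g g' => ?_, fun y => coord_ext fun m m' g h => ?_⟩
    · have := H.mul_left g g' h
      simp only [coord3_comul_left, coord3_leg13_mul_leg23, coord_rMat, ht, hmul]
      by_cases hi : i = π h
      · by_cases hj : j = π h
        · subst hi hj
          revert this
          cases π g <;> cases π g' <;> cases l <;> simp
        · simp [hi, hj, Ne.symm hj]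
      · by_cases hj : i = j
        · subst hj; simp [hi]
        · simp [hi, hj]
    · have := H.mul_right g g' h
      simp only [coord3_comul_right, coord3_leg13_mul_leg12, coord_rMat, ht, hmul]
      by_cases hi : j = π h
      · by_cases hj : l = π h
        · subst hi hj
          revert this
          cases π g <;> cases π g' <;> cases i <;> simp [sigPow]
        · simp [hi, hj, Ne.symm hj]
      · by_cases hj : j = l
        · subst hj; simp [hi]
        · simp [hi, hj]
    · rw [hop, hco]
      have := H.act g h
      by_cases hm : xor (π h) m = xor (π g) m'
      · rw [hm, sigPow_comm _ (π h), sigPow_comm _ (π g)]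
        generalize xor (π g) m' = i
        simp only [if_true]
        cases i
        · simp [tauPow, tw, mul_comm]
        · simp only [tauPow, tw, cond_true] at this ⊢
          linear_combination (co D true (g * h) y * (sigPow D (π h) true g *
            sigPow D (π g) true h)) * this
      · simp [hm, Ne.symm hm]

end RMatrix

end AbExt

/-! ### Symmetric 2-cocycles with divisible values -/

section Coboundary

/-- The extension of `G` by `A` with product `(g, x)(h, y) = (gh, τ(g,h)xy)`. -/
@[ext] structure CocycleExt {G A : Type*} (τ : G → G → A) where
  /-- The component in `G`. -/
  fst : G
  /-- The component in `A`. -/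
  snd : A

variable {G A : Type*} [CommGroup G] [CommGroup A] (τ : G → G → A)

instance : Mul (CocycleExt τ) := ⟨fun y z => ⟨y.1 * z.1, τ y.1 z.1 * y.2 * z.2⟩⟩

instance : One (CocycleExt τ) := ⟨⟨1, 1⟩⟩

instance : Inv (CocycleExt τ) := ⟨fun y => ⟨y.1⁻¹, (τ y.1⁻¹ y.1 * y.2)⁻¹⟩⟩

/-- The group structure of the extension defined by a symmetric unital 2-cocycle. -/
abbrev CocycleExt.commGroup (hone : ∀ g, τ 1 g = 1)
    (hcoc : ∀ g h l, τ g h * τ (g * h) l = τ h l * τ g (h * l))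
    (hsymm : ∀ g h, τ g h = τ h g) : CommGroup (CocycleExt τ) :=
  { Group.ofLeftAxioms (G := CocycleExt τ)
      (fun y z w => CocycleExt.ext (mul_assoc y.1 z.1 w.1) (by
        change τ (y.1 * z.1) w.1 * (τ y.1 z.1 * y.2 * z.2) * w.2 =
          τ y.1 (z.1 * w.1) * y.2 * (τ z.1 w.1 * z.2 * w.2)
        calc _ = (τ y.1 z.1 * τ (y.1 * z.1) w.1) * (y.2 * z.2 * w.2) := by ac_rfl
          _ = _ := by rw [hcoc]; ac_rfl))
      (fun y => CocycleExt.ext (one_mul y.1) (by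
        change τ 1 y.1 * 1 * y.2 = y.2
        rw [hone, one_mul, one_mul]))
      (fun y => CocycleExt.ext (inv_mul_cancel y.1) (by
        change τ y.1⁻¹ y.1 * (τ y.1⁻¹ y.1 * y.2)⁻¹ * y.2 = 1
        rw [mul_right_comm, mul_inv_cancel])) with
    mul_comm := fun y z => CocycleExt.ext (mul_comm y.1 z.1) (by
      change τ y.1 z.1 * y.2 * z.2 = τ z.1 y.1 * z.2 * y.2
      rw [hsymm y.1 z.1]; ac_rfl) }

/-- A symmetric unital 2-cocycle with values in a divisible group is a coboundary. -/
theorem exists_coboundary_of_symm (hA : ∀ m : ℕ, m ≠ 0 → ∀ y : A, ∃ z, z ^ m = y)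
    (hone : ∀ g, τ 1 g = 1) (hcoc : ∀ g h l, τ g h * τ (g * h) l = τ h l * τ g (h * l))
    (hsymm : ∀ g h, τ g h = τ h g) : ∃ c : G → A, ∀ g h, τ g h * c (g * h) = c g * c h := by
  -- Symmetry of `τ` makes the extension abelian, so injectivity of divisible abelian groups can be
  -- used.
  let _ := CocycleExt.commGroup τ hone hcoc hsymm
  have hmul (y z : CocycleExt τ) : y * z = ⟨y.1 * z.1, τ y.1 z.1 * y.2 * z.2⟩ := rfl
  let _ : RootableBy A ℕ := rootableByOfPowLeftSurj A ℕ fun {m} hm y => hA m hm y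
  let _ : RootableBy A ℤ := Group.rootableByIntOfRootableByNat A
  let _ : DivisibleBy (Additive A) ℤ :=
    { div := fun y m => Additive.ofMul (RootableBy.root y.toMul m)
      div_zero := fun y => RootableBy.root_zero (A := A) (α := ℤ) y.toMul
      div_cancel := fun y hm => RootableBy.root_cancel (A := A) y.toMul hm }
  let ι : A →* CocycleExt τ :=
    { toFun := fun y => ⟨1, y⟩
      map_one' := rfl
      map_mul' := fun y z => by rw [hmul]; simp [hone] }
  -- The identity of `A` extends along `ι`, giving a retraction `ρ` of the extension onto `A`.
  obtain ⟨r, hr⟩ := (Module.Baer.of_divisible (Additive A)).extension_property_addMonoidHom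
    (MonoidHom.toAdditive ι) (fun y z h => congrArg CocycleExt.snd h) (AddMonoidHom.id _)
  let ρ : CocycleExt τ →* A := MonoidHom.toAdditive.symm r
  have hρ (y : A) : ρ ⟨1, y⟩ = y := DFunLike.congr_fun hr (Additive.ofMul y)
  -- Apply `ρ` to `(g,1)(h,1) = (1,τ(g,h))(gh,1)`.
  refine ⟨fun g => ρ ⟨g, 1⟩, fun g h => ?_⟩
  rw [← map_mul]
  nth_rewrite 1 [← hρ (τ g h)]
  rw [← map_mul]
  congr 1
  rw [hmul, hmul]
  simp [hone]

variable {τ} in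
/-- `τ(g,h) τ(h,g)⁻¹` is multiplicative in `g`. -/
theorem alternator_mul_left (hcoc : ∀ g h l, τ g h * τ (g * h) l = τ h l * τ g (h * l))
    (g h l : G) : τ (g * h) l / τ l (g * h) = τ g l / τ l g * (τ h l / τ l h) := by
  -- The cocycle identity is used at the triples `(g,h,l)`, `(l,g,h)` and `(g,l,h)`; every factor
  -- outside the two alternators then cancels.
  have e1 : τ (g * h) l = τ h l * τ g (h * l) / τ g h :=
    eq_div_iff_mul_eq'.2 ((mul_comm _ _).trans (hcoc g h l))
  have e2 : τ l (g * h) = τ l g * τ (g * l) h / τ g h :=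
    eq_div_iff_mul_eq'.2 ((mul_comm _ _).trans (by rw [mul_comm g l, hcoc]))
  have e3 : τ g (h * l) = τ g l * τ (g * l) h / τ l h :=
    eq_div_iff_mul_eq'.2 ((mul_comm _ _).trans (by rw [hcoc, mul_comm h l]))
  rw [e1, e2, e3]
  simp only [div_eq_mul_inv, mul_inv_rev, inv_inv]
  have (A' : Type _) [CommGroup A'] (p q r s t u : A') :
      p * (q * r * s⁻¹) * t⁻¹ * (t * (r⁻¹ * u⁻¹)) = q * u⁻¹ * (p * s⁻¹) := by
    calc _ = q * u⁻¹ * (p * s⁻¹) * (t⁻¹ * t) * (r * r⁻¹) := by ac_rfl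
      _ = _ := by simp
  exact this _ _ _ _ _ _ _

end Coboundary

/-! ### The group `G`, the parity given by `T`, and symmetry of `τ` -/

namespace KGroup

variable {n : ℕ}

theorem a_pow_mul_b_pow (i p : ℕ) : a n ^ i * b n ^ p =
    (Multiplicative.ofAdd (i : ZMod (2 * n)), Multiplicative.ofAdd (p : ZMod 2)) := by
  ext
  · simp [a, b, ← ofAdd_nsmul]
  · simp [a, b, ← ofAdd_nsmul]

theorem a_pow_mul_b_pow_eq_iff {i j p r : ℕ} : a n ^ i * b n ^ p = a n ^ j * b n ^ r ↔
    i ≡ j [MOD 2 * n] ∧ p ≡ r [MOD 2] := by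
  rw [a_pow_mul_b_pow, a_pow_mul_b_pow, Prod.mk.injEq, Multiplicative.ofAdd.injective.eq_iff,
    Multiplicative.ofAdd.injective.eq_iff, ZMod.natCast_eq_natCast_iff,
    ZMod.natCast_eq_natCast_iff]

theorem exists_eq_pow [NeZero n] (g : KGroup n) :
    ∃ i < 2 * n, ∃ p < 2, g = a n ^ i * b n ^ p := by
  refine ⟨ZMod.val g.1.toAdd, ZMod.val_lt _, ZMod.val g.2.toAdd, ZMod.val_lt _, ?_⟩
  rw [a_pow_mul_b_pow]
  ext <;> simp

theorem a_pow_two_mul : a n ^ (2 * n) = 1 := by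
  simpa using (a_pow_mul_b_pow_eq_iff (n := n) (i := 2 * n) (j := 0) (p := 0) (r := 0)).2
    ⟨by simp [Nat.ModEq], rfl⟩

theorem b_sq : b n ^ 2 = 1 := by
  simpa using (a_pow_mul_b_pow_eq_iff (n := n) (i := 0) (j := 0) (p := 2) (r := 0)).2
    ⟨rfl, by simp [Nat.ModEq]⟩

theorem b_mul_b : b n * b n = 1 := by rw [← sq, b_sq]

end KGroup

namespace KAlg

open KGroup AbExt

variable {k : Type*} [Field k] {n : ℕ} {D : AbExtData k (KGroup n)}

theorem act_pow (hD : IsKData D) (i p : ℕ) :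
    D.act (a n ^ i * b n ^ p) = a n ^ i * b n ^ (p + i) := by
  rw [map_mul, map_pow, map_pow, hD.act_a, hD.act_b, mul_pow, pow_add, mul_assoc,
    mul_comm (b n ^ i)]

variable (D) in
/-- Whether `g` is moved by the action of `x`. -/
def moved (g : KGroup n) : Bool := decide (D.act g ≠ g)

/-- The action multiplies `a^i` by `b^i`, and `b` has order two. -/
theorem moved_pow (hD : IsKData D) (i p : ℕ) :
    moved D (a n ^ i * b n ^ p) = decide (i % 2 = 1) := by
  refine decide_eq_decide.2 ?_
  rw [act_pow hD, ne_eq, a_pow_mul_b_pow_eq_iff]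
  simp only [Nat.ModEq, true_and]
  omega

theorem moved_mul [NeZero n] (hD : IsKData D) (g h : KGroup n) :
    moved D (g * h) = xor (moved D g) (moved D h) := by
  obtain ⟨i, -, p, -, rfl⟩ := exists_eq_pow g
  obtain ⟨j, -, r, -, rfl⟩ := exists_eq_pow h
  rw [mul_mul_mul_comm, ← pow_add, ← pow_add, moved_pow hD, moved_pow hD, moved_pow hD]
  rcases Nat.mod_two_eq_zero_or_one i with hi | hi <;>
    rcases Nat.mod_two_eq_zero_or_one j with hj | hj <;> simp [Nat.add_mod, hi, hj]

theorem moved_act (g : KGroup n) : moved D (D.act g) = moved D g := by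
  rw [moved, moved]
  exact decide_eq_decide.2 (not_congr D.act.injective.eq_iff)

/-- If the `a`-exponents `i, j` are both odd, the twists contribute `b^(i+j) = 1`; if just one is
odd, the only twist acts on the element with even exponent, which is fixed. -/
theorem tw_moved_mul_tw_moved [NeZero n] (hD : IsKData D) (g h : KGroup n) :
    tw D (moved D h) g * tw D (moved D g) h = g * h := by
  obtain ⟨i, -, p, -, rfl⟩ := exists_eq_pow g
  obtain ⟨j, -, r, -, rfl⟩ := exists_eq_pow h
  rw [moved_pow hD, moved_pow hD]
  rcases Nat.mod_two_eq_zero_or_one i with hi | hi <;>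
    rcases Nat.mod_two_eq_zero_or_one j with hj | hj <;>
    simp only [tw, hi, hj, zero_ne_one, decide_false, decide_true, cond_false, cond_true,
      act_pow hD] <;>
    simp only [mul_mul_mul_comm _ (b n ^ _), ← pow_add, a_pow_mul_b_pow_eq_iff, Nat.ModEq,
      true_and] <;> omega

/-- The alternator `τ(g,l)/τ(l,g)` is multiplicative in `g`, hence also in `l` because swapping
inverts it. It is `1` on the diagonal, so its value at `(a,b)` decides everything. -/
theorem tau_symm [NeZero n] (hη : eta D (a n) (b n) = 1) (g h : KGroup n) :
    D.τ g h = D.τ h g := by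
  have hm := alternator_mul_left D.τ_cocycle
  have hp (g l : KGroup n) (i : ℕ) :
      D.τ (g ^ i) l / D.τ l (g ^ i) = (D.τ g l / D.τ l g) ^ i := by
    induction i with
    | zero => simp [D.τ_one_left, D.τ_one_right]
    | succ i ih => rw [pow_succ, hm, ih, pow_succ]
  have h0 : D.τ (a n) (b n) / D.τ (b n) (a n) = 1 := by
    ext
    simpa [eta, div_eq_mul_inv] using hη
  have key (l : KGroup n) (ha : D.τ (a n) l / D.τ l (a n) = 1)
      (hb : D.τ (b n) l / D.τ l (b n) = 1) (g : KGroup n) : D.τ g l / D.τ l g = 1 := by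
    obtain ⟨i, -, p, -, rfl⟩ := exists_eq_pow g
    rw [hm, hp, hp, ha, hb, one_pow, one_pow, one_mul]
  have flip {g l : KGroup n} (H : D.τ g l / D.τ l g = 1) : D.τ l g / D.τ g l = 1 := by
    rw [← inv_div, H, inv_one]
  refine div_eq_one.1 (key h (flip ?_) (flip ?_) g)
  · exact key (a n) (div_self' _) (flip h0) h
  · exact key (b n) h0 (div_self' _) h

theorem exists_tau_eq [NeZero n] [IsAlgClosed k] (hη : eta D (a n) (b n) = 1) :
    ∃ c : KGroup n → kˣ, ∀ g h, D.τ g h * c (g * h) = c g * c h := by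
  refine exists_coboundary_of_symm D.τ (fun m hm y => ?_) D.τ_one_left D.τ_cocycle
    (tau_symm hη)
  obtain ⟨z, hz⟩ := IsAlgClosed.exists_pow_nat_eq (y : k) (Nat.pos_of_ne_zero hm)
  have hz0 : z ≠ 0 := by
    rintro rfl
    rw [zero_pow hm] at hz
    exact y.ne_zero hz.symm
  exact ⟨Units.mk0 z hz0, Units.ext (by simpa using hz)⟩

end KAlg

/-! ### The trivial structures -/

namespace KGroup

variable {n : ℕ}

/-- Functions of pairs of elements `a^i b^p` given by formulas periodic in the exponents. -/
theorem exists_fun_of_periodic [NeZero n] {k : Type*} (f : ℕ → ℕ → ℕ → ℕ → k)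
    (h1 : ∀ i p j r, f (i + 2 * n) p j r = f i p j r)
    (h2 : ∀ i p j r, f i (p + 2) j r = f i p j r)
    (h3 : ∀ i p j r, f i p (j + 2 * n) r = f i p j r)
    (h4 : ∀ i p j r, f i p j (r + 2) = f i p j r) :
    ∃ w : KGroup n → KGroup n → k,
      ∀ i p j r, w (a n ^ i * b n ^ p) (a n ^ j * b n ^ r) = f i p j r := by
  refine ⟨fun g h => f (ZMod.val g.1.toAdd) (ZMod.val g.2.toAdd) (ZMod.val h.1.toAdd)
    (ZMod.val h.2.toAdd), fun i p j r => ?_⟩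
  have e1 := Function.Periodic.map_mod_nat (f := fun i => f i (p % 2) (j % (2 * n)) (r % 2))
    (fun _ => h1 _ _ _ _) i
  have e2 := Function.Periodic.map_mod_nat (f := fun p => f i p (j % (2 * n)) (r % 2))
    (fun _ => h2 _ _ _ _) p
  have e3 := Function.Periodic.map_mod_nat (f := fun j => f i p j (r % 2))
    (fun _ => h3 _ _ _ _) j
  have e4 := Function.Periodic.map_mod_nat (f := fun r => f i p j r) (fun _ => h4 _ _ _ _) r
  simp only [a_pow_mul_b_pow, toAdd_ofAdd, ZMod.val_natCast]
  exact e1.trans (e2.trans (e3.trans e4))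

theorem sum_eq_sum_Icc [NeZero n] {M : Type*} [AddCommMonoid M] (F : KGroup n → M) :
    ∑ g, F g = ∑ i ∈ Finset.Icc 1 (2 * n), ∑ j ∈ Finset.Icc 1 2, F (a n ^ i * b n ^ j) := by
  rw [← Finset.sum_product']
  symm
  refine Finset.sum_nbij (fun x => a n ^ x.1 * b n ^ x.2) (by simp) ?_ ?_ (by simp)
  · rintro ⟨i, p⟩ hx ⟨j, r⟩ hy H
    simp only [Finset.coe_product, Finset.coe_Icc, Set.mem_prod, Set.mem_Icc] at hx hy
    obtain ⟨h1, h2⟩ := a_pow_mul_b_pow_eq_iff.1 H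
    have e1 : i - 1 = j - 1 := Nat.ModEq.eq_of_lt_of_lt (m := 2 * n)
      (Nat.ModEq.add_right_cancel' 1 (by simpa [hx.1.1, hy.1.1] using h1)) (by omega) (by omega)
    simp only [Nat.ModEq] at h2
    simp only [Prod.mk.injEq]
    omega
  · intro g _
    obtain ⟨i, hi, p, hp, rfl⟩ := exists_eq_pow g
    -- The ranges start at `1`, so the zero residues are represented by `2n` and `2`.
    refine ⟨(if i = 0 then 2 * n else i, if p = 0 then 2 else p), ?_, ?_⟩
    · have := Nat.pos_of_neZero n
      simp only [Finset.coe_product, Finset.coe_Icc, Set.mem_prod, Set.mem_Icc]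
      split_ifs <;> omega
    · dsimp only
      rw [a_pow_mul_b_pow_eq_iff]
      split_ifs <;> simp_all [Nat.ModEq]

end KGroup

namespace KAlg

open KGroup AbExt

variable {k : Type*} [Field k] {n : ℕ} {D : AbExtData k (KGroup n)}

theorem isTrivialStructure_iff [NeZero n] (R : AbExt D ⊗[k] AbExt D) :
    IsTrivialStructure D R ↔ ∃ w, R = rMat D (fun _ => false) w ∧
      IsRFunction D (fun _ => false) w := by
  have hR (w : KGroup n → KGroup n → k) : rMat D (fun _ => false) w =
      ∑ g, ∑ h, w g h • (e D g ⊗ₜ[k] e D h) := rfl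
  have hU := isUniversalRMatrix_rMat_iff (D := D) (π := fun _ => false) (fun _ => rfl)
    (fun _ _ => rfl) (fun _ _ => rfl)
  constructor
  · rintro ⟨H, w, rfl⟩
    exact ⟨w, (hR w).symm, (hU w).1 H⟩
  · rintro ⟨w, rfl, H⟩
    exact ⟨(hU w).2 H, w, hR w⟩

/-- With `π = 0` no twist and no `σ` occurs, and the two values of `τ` in the last condition cancel
by symmetry. -/
theorem isRFunction_false_iff (hτ : ∀ g h, D.τ g h = D.τ h g)
    (w : KGroup n → KGroup n → k) : IsRFunction D (fun _ => false) w ↔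
      (∀ g h, w g h ≠ 0) ∧ (∀ g g' h, w (g * g') h = w g h * w g' h) ∧
      (∀ g g' h, w h (g * g') = w h g * w h g') ∧
      ∀ g h, w (D.act g) (D.act h) = w g h := by
  constructor
  · intro H
    refine ⟨H.ne_zero, fun g g' h => ?_, fun g g' h => ?_, fun g h => ?_⟩
    · simpa [tauPow, sigPow, tw] using H.mul_left g g' h
    · simpa [tauPow, sigPow, tw, mul_comm] using H.mul_right g g' h
    · have := H.act g h
      rw [hτ, mul_comm] at this
      exact mul_right_cancel₀ (Units.ne_zero _) this
  · rintro ⟨h0, h1, h2, h3⟩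
    refine ⟨h0, fun g g' h => ?_, fun g g' h => ?_, fun g h => ?_⟩
    · simp [tauPow, sigPow, tw, h1]
    · simp [tauPow, sigPow, tw, h2, mul_comm]
    · rw [h3, hτ, mul_comm]; rfl

/-- The exponents of `b` in `RTrivial` are integers, whereas the sum over the group runs over
natural exponents. -/
theorem sum_Icc_one_two {M : Type*} [AddCommMonoid M] (f : ℤ → M) :
    ∑ j ∈ Finset.Icc 1 2, f j = ∑ j ∈ Finset.Icc (1 : ℕ) 2, f j := by
  rw [show Finset.Icc (1 : ℤ) 2 = {1, 2} from rfl, show Finset.Icc (1 : ℕ) 2 = {1, 2} from rfl]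
  simp

theorem rTrivial_eq [NeZero n] {α β : k} {w : KGroup n → KGroup n → k}
    (hw : ∀ i j m l : ℕ, w (a n ^ i * b n ^ j) (a n ^ m * b n ^ l) =
      α ^ (i * m) * β ^ ((i : ℤ) * l - (j : ℤ) * m)) :
    RTrivial D α β = rMat D (fun _ => false) w := by
  simp only [rMat, RTrivial, sum_eq_sum_Icc, hw, sum_Icc_one_two, zpow_natCast]
  rfl

theorem exists_of_isRFunction_false [NeZero n] (hD : IsKData D)
    (hτ : ∀ g h, D.τ g h = D.τ h g) {w : KGroup n → KGroup n → k}
    (H : IsRFunction D (fun _ => false) w) :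
    ∃ α β : k, α ^ (2 * n) = 1 ∧ β ^ 2 = 1 ∧ ∀ i j m l : ℕ,
      w (a n ^ i * b n ^ j) (a n ^ m * b n ^ l) =
        α ^ (i * m) * β ^ ((i : ℤ) * l - (j : ℤ) * m) := by
  obtain ⟨h0, h1, h2, h3⟩ := (isRFunction_false_iff hτ w).1 H
  have l1 (h : KGroup n) : w 1 h = 1 := by
    have := h1 1 1 h
    rw [mul_one] at this
    exact (mul_eq_left₀ (h0 1 h)).1 this.symm
  have r1 (g : KGroup n) : w g 1 = 1 := by
    have := h2 1 1 g
    rw [mul_one] at this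
    exact (mul_eq_left₀ (h0 g 1)).1 this.symm
  have lp (g h : KGroup n) (i : ℕ) : w (g ^ i) h = w g h ^ i := by
    induction i with
    | zero => simp [l1]
    | succ i ih => rw [pow_succ, h1, ih, pow_succ]
  have rp (g h : KGroup n) (i : ℕ) : w g (h ^ i) = w g h ^ i := by
    induction i with
    | zero => simp [r1]
    | succ i ih => rw [pow_succ, h2, ih, pow_succ]
  -- Invariance at `(a,b)` reads `w(ab,b) = w(a,b)`; next, at `(a,a)`, it reads `w(ab,ab) = w(a,a)`.
  have hbb : w (b n) (b n) = 1 := by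
    have := h3 (a n) (b n)
    rw [hD.act_a, hD.act_b, h1] at this
    exact (mul_eq_left₀ (h0 _ _)).1 this
  have hba : w (b n) (a n) = (w (a n) (b n))⁻¹ := by
    have := h3 (a n) (a n)
    rw [hD.act_a, h1, h2, h2, hbb, mul_one, mul_assoc] at this
    exact eq_inv_of_mul_eq_one_right ((mul_eq_left₀ (h0 _ _)).1 this)
  refine ⟨w (a n) (a n), w (a n) (b n), ?_, ?_, fun i j m l => ?_⟩
  · rw [← lp, a_pow_two_mul, l1]
  · rw [← rp, b_sq, r1]
  · have hβ := h0 (a n) (b n)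
    rw [h1, h2, h2, lp, lp, lp, lp, rp, rp, rp, rp, hbb, hba, zpow_sub₀ hβ, div_eq_mul_inv,
      ← inv_zpow]
    norm_cast
    simp only [← pow_mul, one_pow, mul_one, Nat.cast_one]
    rw [mul_comm m i, mul_comm l i, mul_comm m j, mul_assoc]

theorem exists_isRFunction_false [NeZero n] (hD : IsKData D)
    (hτ : ∀ g h, D.τ g h = D.τ h g) {α β : k} (hα : α ^ (2 * n) = 1) (hβ : β ^ 2 = 1) :
    ∃ w, IsRFunction D (fun _ => false) w ∧ ∀ i j m l : ℕ,
      w (a n ^ i * b n ^ j) (a n ^ m * b n ^ l) =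
        α ^ (i * m) * β ^ ((i : ℤ) * l - (j : ℤ) * m) := by
  have hα0 : α ≠ 0 := by
    rintro rfl
    rw [zero_pow (by simp [NeZero.ne n])] at hα
    exact zero_ne_one hα
  have hβ0 : β ≠ 0 := by
    rintro rfl
    simp at hβ
  -- As `β² = 1`, the sign in the exponent is irrelevant; natural exponents make the periodicity
  -- checks polynomial identities.
  have hf (i j m l : ℕ) : β ^ ((i : ℤ) * l - (j : ℤ) * m) = β ^ (i * l + j * m) := by
    have : (i : ℤ) * l - (j : ℤ) * m = ((i * l + j * m : ℕ) : ℤ) + (2 : ℕ) * (-(j * m : ℤ)) := by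
      push_cast
      ring
    rw [this, zpow_add₀ hβ0, zpow_natCast, zpow_mul, zpow_natCast, hβ, one_zpow, mul_one]
  simp only [hf]
  have hα' (m : ℕ) : α ^ (2 * n * m) = 1 := by rw [pow_mul, hα, one_pow]
  have hβ' (m : ℕ) : β ^ (2 * m) = 1 := by rw [pow_mul, hβ, one_pow]
  obtain ⟨w, hw⟩ := exists_fun_of_periodic (n := n)
    (fun i j m l => α ^ (i * m) * β ^ (i * l + j * m))
    (fun i p j r => by
      have e1 : (i + 2 * n) * j = i * j + 2 * n * j := by ring
      have e2 : (i + 2 * n) * r + p * j = i * r + p * j + 2 * (n * r) := by ring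
      rw [e1, e2, pow_add, pow_add _ _ (2 * _), hα', hβ', mul_one, mul_one])
    (fun i p j r => by
      have e2 : i * r + (p + 2) * j = i * r + p * j + 2 * j := by ring
      rw [e2, pow_add _ _ (2 * _), hβ', mul_one])
    (fun i p j r => by
      have e1 : i * (j + 2 * n) = i * j + 2 * n * i := by ring
      have e2 : i * r + p * (j + 2 * n) = i * r + p * j + 2 * (n * p) := by ring
      rw [e1, e2, pow_add, pow_add _ _ (2 * _), hα', hβ', mul_one, mul_one])
    (fun i p j r => by
      have e2 : i * (r + 2) + p * j = i * r + p * j + 2 * i := by ring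
      rw [e2, pow_add _ _ (2 * _), hβ', mul_one])
  refine ⟨w, (isRFunction_false_iff hτ w).2 ⟨fun g h => ?_, fun g g' h => ?_, fun g g' h => ?_,
    fun g h => ?_⟩, hw⟩
  · obtain ⟨i, -, p, -, rfl⟩ := exists_eq_pow g
    obtain ⟨j, -, r, -, rfl⟩ := exists_eq_pow h
    rw [hw]
    positivity
  · obtain ⟨i, -, p, -, rfl⟩ := exists_eq_pow g
    obtain ⟨i', -, p', -, rfl⟩ := exists_eq_pow g'
    obtain ⟨j, -, r, -, rfl⟩ := exists_eq_pow h
    rw [mul_mul_mul_comm, ← pow_add, ← pow_add, hw, hw, hw]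
    ring
  · obtain ⟨i, -, p, -, rfl⟩ := exists_eq_pow g
    obtain ⟨i', -, p', -, rfl⟩ := exists_eq_pow g'
    obtain ⟨j, -, r, -, rfl⟩ := exists_eq_pow h
    rw [mul_mul_mul_comm, ← pow_add, ← pow_add, hw, hw, hw]
    ring
  · obtain ⟨i, -, p, -, rfl⟩ := exists_eq_pow g
    obtain ⟨j, -, r, -, rfl⟩ := exists_eq_pow h
    rw [act_pow hD, act_pow hD, hw, hw]
    have e2 : i * (r + j) + (p + i) * j = i * r + p * j + 2 * (i * j) := by ring
    rw [e2, pow_add _ _ (2 * _), hβ', mul_one]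

/-- The classification of the trivial structures. -/
theorem isTrivialStructure_iff_exists [NeZero n] (hD : IsKData D)
    (hτ : ∀ g h, D.τ g h = D.τ h g) (R : AbExt D ⊗[k] AbExt D) :
    IsTrivialStructure D R ↔
      ∃ α β : k, α ^ (2 * n) = 1 ∧ β ^ 2 = 1 ∧ R = RTrivial D α β := by
  rw [isTrivialStructure_iff]
  constructor
  · rintro ⟨w, rfl, H⟩
    obtain ⟨α, β, hα, hβ, hw⟩ := exists_of_isRFunction_false hD hτ H
    exact ⟨α, β, hα, hβ, (rTrivial_eq hw).symm⟩
  · rintro ⟨α, β, hα, hβ, rfl⟩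
    obtain ⟨w, H, hw⟩ := exists_isRFunction_false hD hτ hα hβ
    exact ⟨w, rTrivial_eq hw, H⟩

end KAlg

/-! ### The non-trivial structures: one coefficient function and removal of `τ` -/

namespace KGroup

variable {n : ℕ}

theorem sum_eq_sum_range [NeZero n] {M : Type*} [AddCommMonoid M] (F : KGroup n → M) :
    ∑ g, F g = ∑ i ∈ Finset.range n, ∑ p : Fin 2,
      (F (a n ^ (2 * i) * b n ^ (p : ℕ)) + F (a n ^ (2 * i + 1) * b n ^ (p : ℕ))) := by
  have h1 (i : ℕ) (p : Fin 2) :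
      F (a n ^ (2 * i) * b n ^ (p : ℕ)) + F (a n ^ (2 * i + 1) * b n ^ (p : ℕ)) =
        ∑ d : Fin 2, F (a n ^ (2 * i + d) * b n ^ (p : ℕ)) := by
    rw [Fin.sum_univ_two]; rfl
  simp only [h1]
  rw [← Finset.sum_product', ← Finset.sum_product']
  symm
  refine Finset.sum_nbij (fun x => a n ^ (2 * x.1.1 + x.2) * b n ^ (x.1.2 : ℕ)) (by simp)
    ?_ ?_ (by simp)
  · rintro ⟨⟨i, p⟩, d⟩ hx ⟨⟨j, r⟩, d'⟩ hy H
    simp only [Finset.coe_product, Finset.coe_range, Finset.coe_univ, Set.mem_prod, Set.mem_Iio,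
      Set.mem_univ, and_true] at hx hy
    obtain ⟨h1, h2⟩ := a_pow_mul_b_pow_eq_iff.1 H
    have e1 := Nat.ModEq.eq_of_lt_of_lt h1 (by dsimp only; omega) (by dsimp only; omega)
    have e2 := Nat.ModEq.eq_of_lt_of_lt h2 p.2 r.2
    dsimp only at e1 e2
    simp only [Prod.mk.injEq, Fin.ext_iff]
    omega
  · intro g _
    obtain ⟨i, hi, p, hp, rfl⟩ := exists_eq_pow g
    refine ⟨((i / 2, ⟨p, hp⟩), ⟨i % 2, Nat.mod_lt _ two_pos⟩), ?_, ?_⟩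
    · simp only [Finset.coe_product, Finset.coe_range, Finset.coe_univ, Set.mem_prod,
        Set.mem_Iio, Set.mem_univ, and_true]
      omega
    · dsimp only
      rw [Nat.div_add_mod]

end KGroup

namespace KAlg

open KGroup AbExt

variable {k : Type*} [Field k] {n : ℕ} {D : AbExtData k (KGroup n)}

theorem moved_a (hD : IsKData D) : moved D (a n) = true := by
  simpa using moved_pow hD 1 0

theorem moved_b (hD : IsKData D) : moved D (b n) = false := by
  simpa using moved_pow hD 0 1

/-- Splitting both sums into fixed and moved elements makes the powers of `x` constant on each of
the four blocks. -/
theorem rMat_moved_eq [NeZero n] (w : KGroup n → KGroup n → k) : rMat D (moved D) w =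
    (∑ s₁ ∈ fixedSet D, ∑ s₂ ∈ fixedSet D, w s₁ s₂ • (e D s₁ ⊗ₜ[k] e D s₂)) +
    (∑ s ∈ fixedSet D, ∑ t ∈ movedSet D, w s t • (ex D s ⊗ₜ[k] e D t)) +
    (∑ t ∈ movedSet D, ∑ s ∈ fixedSet D, w t s • (e D t ⊗ₜ[k] ex D s)) +
    (∑ t₁ ∈ movedSet D, ∑ t₂ ∈ movedSet D, w t₁ t₂ • (ex D t₁ ⊗ₜ[k] ex D t₂)) := by
  have hsplit {M : Type _} [AddCommMonoid M] (F : KGroup n → M) :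
      ∑ g, F g = ∑ g ∈ fixedSet D, F g + ∑ g ∈ movedSet D, F g :=
    (Finset.sum_filter_add_sum_filter_not _ _ _).symm
  have hf {g : KGroup n} (hg : g ∈ fixedSet D) : moved D g = false := by
    simpa [fixedSet, moved] using hg
  have hm {g : KGroup n} (hg : g ∈ movedSet D) : moved D g = true := by
    simpa [movedSet, moved] using hg
  have key (A B : Finset (KGroup n)) (i j : Bool) (hA : ∀ g ∈ A, moved D g = j)
      (hB : ∀ g ∈ B, moved D g = i) :
      ∑ g ∈ A, ∑ h ∈ B, w g h • (bas D (moved D h) g ⊗ₜ[k] bas D (moved D g) h) =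
        ∑ g ∈ A, ∑ h ∈ B, w g h • (bas D i g ⊗ₜ[k] bas D j h) :=
    Finset.sum_congr rfl fun g hg => Finset.sum_congr rfl fun h hh => by rw [hA g hg, hB h hh]
  rw [rMat, hsplit]
  simp only [hsplit, Finset.sum_add_distrib]
  rw [key _ _ false false (fun _ => hf) (fun _ => hf), key _ _ true false (fun _ => hf)
    (fun _ => hm), key _ _ false true (fun _ => hm) (fun _ => hf), key _ _ true true
    (fun _ => hm) (fun _ => hm), ← add_assoc]
  rfl

theorem isNontrivialStructure_iff [NeZero n] (hD : IsKData D) (R : AbExt D ⊗[k] AbExt D) :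
    IsNontrivialStructure D R ↔ ∃ w, R = rMat D (moved D) w ∧ IsRFunction D (moved D) w := by
  have hU := isUniversalRMatrix_rMat_iff (D := D) moved_act (moved_mul hD)
    (tw_moved_mul_tw_moved hD)
  constructor
  · rintro ⟨H, w1, w2, w3, w4, hR⟩
    -- The four coefficient families live on disjoint blocks of `G × G`, so they glue to one
    -- function.
    let w : KGroup n → KGroup n → k := fun g h =>
      if D.act g = g then (if D.act h = h then w1 g h else w2 g h)
      else (if D.act h = h then w3 g h else w4 g h)
    have hw : R = rMat D (moved D) w := by
      rw [hR, rMat_moved_eq]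
      congr 1
      · congr 1
        · congr 1 <;>
            refine Finset.sum_congr rfl fun g hg => Finset.sum_congr rfl fun h hh => ?_ <;>
            simp only [fixedSet, movedSet, Finset.mem_filter, Finset.mem_univ, true_and] at hg hh <;>
            simp [w, hg, hh]
        · refine Finset.sum_congr rfl fun g hg => Finset.sum_congr rfl fun h hh => ?_
          simp only [fixedSet, movedSet, Finset.mem_filter, Finset.mem_univ, true_and] at hg hh
          simp [w, hg, hh]
      · refine Finset.sum_congr rfl fun g hg => Finset.sum_congr rfl fun h hh => ?_
        simp only [movedSet, Finset.mem_filter, Finset.mem_univ, true_and] at hg hh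
        simp [w, hg, hh]
    exact ⟨w, hw, (hU w).1 (hw ▸ H)⟩
  · rintro ⟨w, rfl, H⟩
    exact ⟨(hU w).2 H, w, w, w, w, rMat_moved_eq w⟩

theorem rPrime_eq [NeZero n] (hD : IsKData D) {α β : k} {w : KGroup n → KGroup n → k}
    (h1 : ∀ (i j : ℕ) (p q : Fin 2),
      w (a n ^ (2 * i) * b n ^ (p : ℕ)) (a n ^ (2 * j) * b n ^ (q : ℕ)) = w1 D α β i j)
    (h2 : ∀ (i j : ℕ) (p q : Fin 2),
      w (a n ^ (2 * i) * b n ^ (p : ℕ)) (a n ^ (2 * j + 1) * b n ^ (q : ℕ)) = w2 D α β i p j)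
    (h3 : ∀ (i j : ℕ) (p q : Fin 2),
      w (a n ^ (2 * i + 1) * b n ^ (p : ℕ)) (a n ^ (2 * j) * b n ^ (q : ℕ)) = w3 D α β i j q)
    (h4 : ∀ (i j : ℕ) (p q : Fin 2),
      w (a n ^ (2 * i + 1) * b n ^ (p : ℕ)) (a n ^ (2 * j + 1) * b n ^ (q : ℕ)) =
        w4 D α β i p j q) :
    rMat D (moved D) w = RPrime D α β := by
  have m0 (i p : ℕ) : moved D (a n ^ (2 * i) * b n ^ p) = false := by
    simp [moved_pow hD]
  have m1 (i p : ℕ) : moved D (a n ^ (2 * i + 1) * b n ^ p) = true := by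
    simp [moved_pow hD, Nat.add_mod]
  rw [rMat, sum_eq_sum_range, RPrime]
  refine Finset.sum_congr rfl fun i _ => Finset.sum_congr rfl fun p _ => ?_
  rw [sum_eq_sum_range, sum_eq_sum_range, ← Finset.sum_add_distrib]
  refine Finset.sum_congr rfl fun j _ => ?_
  rw [← Finset.sum_add_distrib]
  refine Finset.sum_congr rfl fun q _ => ?_
  rw [m0, m1, m0, m1, h1, h2, h3, h4, ← add_assoc]
  rfl

variable (D) in
/-- The conditions on the coefficients of a non-trivial structure after a change of `e_g x`
to a multiple that makes `τ` trivial and `σ` a character `ζ`. -/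
structure IsUntwisted (ζ : KGroup n → k) (W : KGroup n → KGroup n → k) : Prop where
  ne_zero : ∀ g h, W g h ≠ 0
  mul_left : ∀ g g' h, W (g * g') h =
    W g h * W g' (tw D (moved D g) h) * cond (moved D g && moved D g') (ζ h) 1
  mul_right : ∀ g g' h, W h (g * g') =
    W h g' * W (tw D (moved D g') h) g * cond (moved D g && moved D g') (ζ h) 1
  act : ∀ g h, W (D.act g) (D.act h) = W g h

/-- Each `x` in a term of `R` contributes one factor `c`. With these factors inserted, every
condition becomes its untwisted counterpart times a nonzero scalar: `f1`–`f4` extract the scalar,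
`e1`–`e3` cancel it. -/
theorem isRFunction_moved_iff [NeZero n] (hD : IsKData D) {c : KGroup n → kˣ}
    (hc : ∀ g h, (D.τ g h * c (g * h) : k) = c g * c h) (W : KGroup n → KGroup n → k) :
    IsRFunction D (moved D)
      (fun g h => W g h * (cond (moved D h) (c g : k) 1 * cond (moved D g) (c h : k) 1)) ↔
    IsUntwisted D (fun g => D.σ g * c g * c (D.act g)) W := by
  have ht (i : Bool) (g : KGroup n) : moved D (tw D i g) = moved D g := by
    cases i <;> simp [tw, moved_act]
  have hcond (i : Bool) (g : KGroup n) : cond i (c g : k) 1 ≠ 0 := by cases i <;> simp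
  have e0 (g h : KGroup n) : W g h * (cond (moved D h) (c g : k) 1 * cond (moved D g) (c h : k) 1)
      ≠ 0 ↔ W g h ≠ 0 := by simp [hcond]
  have e1 (g g' h : KGroup n) := mul_right_inj' (b := W (g * g') h)
    (c := W g h * W g' (tw D (moved D g) h) *
      cond (moved D g && moved D g') (D.σ h * c h * c (D.act h) : k) 1)
    (mul_ne_zero (mul_ne_zero (hcond (moved D h) g) (hcond (moved D h) g'))
      (hcond (xor (moved D g) (moved D g')) h))
  have e2 (g g' h : KGroup n) := mul_right_inj' (b := W h (g * g'))
    (c := W h g' * W (tw D (moved D g') h) g *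
      cond (moved D g && moved D g') (D.σ h * c h * c (D.act h) : k) 1)
    (mul_ne_zero (mul_ne_zero (hcond (moved D h) g) (hcond (moved D h) g'))
      (hcond (xor (moved D g) (moved D g')) h))
  have e3 (g h : KGroup n) := mul_right_inj' (b := W (D.act g) (D.act h)) (c := W g h)
    (mul_ne_zero (mul_ne_zero (c g).ne_zero (c h).ne_zero) (mul_ne_zero
      (hcond (moved D h) (D.act g)) (hcond (moved D g) (D.act h))))
  have f1 (g g' h : KGroup n) : tauPow D (moved D h) g g' * (W (g * g') h *
      (cond (moved D h) (c (g * g') : k) 1 * cond (moved D (g * g')) (c h : k) 1)) =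
      cond (moved D h) (c g : k) 1 * cond (moved D h) (c g' : k) 1 *
        cond (xor (moved D g) (moved D g')) (c h : k) 1 * W (g * g') h := by
    rw [moved_mul hD]
    cases moved D h <;> simp only [tauPow, cond_true, cond_false]
    · ring
    · linear_combination W (g * g') h * cond (xor (moved D g) (moved D g')) (c h : k) 1 *
        hc g g'
  have f2 (g g' h : KGroup n) : tauPow D (moved D h) g g' * (W h (g * g') *
      (cond (moved D (g * g')) (c h : k) 1 * cond (moved D h) (c (g * g') : k) 1)) =
      cond (moved D h) (c g : k) 1 * cond (moved D h) (c g' : k) 1 *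
        cond (xor (moved D g) (moved D g')) (c h : k) 1 * W h (g * g') := by
    rw [moved_mul hD]
    cases moved D h <;> simp only [tauPow, cond_true, cond_false]
    · ring
    · linear_combination W h (g * g') * cond (xor (moved D g) (moved D g')) (c h : k) 1 *
        hc g g'
  -- Multiplying by `c(hg)` clears both values of `τ` in the last condition, since the twisted pair
  -- in `f4` has the same product.
  have f3 (g h : KGroup n) : (c (h * g) : k) * (D.τ h g * (W (D.act g) (D.act h) *
      (cond (moved D (D.act h)) (c (D.act g) : k) 1 *
        cond (moved D (D.act g)) (c (D.act h) : k) 1))) =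
      c g * c h * (cond (moved D h) (c (D.act g) : k) 1 *
        cond (moved D g) (c (D.act h) : k) 1) * W (D.act g) (D.act h) := by
    rw [moved_act, moved_act]
    linear_combination (W (D.act g) (D.act h) * (cond (moved D h) (c (D.act g) : k) 1 *
      cond (moved D g) (c (D.act h) : k) 1)) * hc h g
  have f4 (g h : KGroup n) : (c (h * g) : k) * (W g h * (cond (moved D h) (c g : k) 1 *
      cond (moved D g) (c h : k) 1) * D.τ (tw D (moved D h) g) (tw D (moved D g) h)) =
      c g * c h * (cond (moved D h) (c (D.act g) : k) 1 *
        cond (moved D g) (c (D.act h) : k) 1) * W g h := by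
    have h2 := hc (tw D (moved D h) g) (tw D (moved D g) h)
    rw [tw_moved_mul_tw_moved hD, mul_comm g h] at h2
    have h3 : c g * c h * (cond (moved D h) (c (D.act g) : k) 1 *
        cond (moved D g) (c (D.act h) : k) 1) = cond (moved D h) (c g : k) 1 *
        cond (moved D g) (c h : k) 1 * (c (tw D (moved D h) g) * c (tw D (moved D g) h)) := by
      cases moved D g <;> cases moved D h <;> simp [tw] <;> ring
    rw [h3, ← h2]
    ring
  constructor
  · intro H
    refine ⟨fun g h => (e0 g h).1 (H.ne_zero g h), fun g g' h => ?_, fun g g' h => ?_,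
      fun g h => ?_⟩
    · have := H.mul_left g g' h
      rw [f1] at this
      refine (e1 g g' h).1 (this.trans ?_)
      rw [ht]
      cases moved D g <;> cases moved D g' <;> simp [sigPow, tw] <;> ring
    · have := H.mul_right g g' h
      rw [f2] at this
      refine (e2 g g' h).1 (this.trans ?_)
      rw [ht]
      cases moved D g <;> cases moved D g' <;> simp [sigPow, tw] <;> ring
    · have := H.act g h
      refine (e3 g h).1 ?_
      rw [← f3, ← f4, this]
  · intro H
    refine ⟨fun g h => (e0 g h).2 (H.ne_zero g h), fun g g' h => ?_, fun g g' h => ?_,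
      fun g h => ?_⟩
    · rw [f1, H.mul_left g g' h, ht]
      cases moved D g <;> cases moved D g' <;> simp [sigPow, tw] <;> ring
    · rw [f2, H.mul_right g g' h, ht]
      cases moved D g <;> cases moved D g' <;> simp [sigPow, tw] <;> ring
    · refine mul_left_cancel₀ (c (h * g)).ne_zero ?_
      rw [f3, f4, H.act]

end KAlg

/-! ### Solution of the untwisted equations -/

namespace KAlg

open KGroup AbExt

variable {k : Type*} [Field k] {n : ℕ} {D : AbExtData k (KGroup n)}

/-- The normalized coefficients of a non-trivial structure as functions of the exponents:
the value at `(a^{2i+d} b^p, a^{2j+d'} b^r)`, with `d, d' ∈ {0, 1}`. -/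
def coeffFormula (z u ε : k) (i d p j d' r : ℕ) : k :=
  (ε * u ^ 2 * z) ^ (2 * i * j + i * d' + j * d) * z ^ (2 * i * j) * ε ^ (p * d' + r * d) *
    u ^ (d * d')

/-- Fixed elements can be split off either argument without a twist. Writing elements as `(a²)^i b^p
a^d` therefore leaves only values at `a²`, `b` and `a`, and all of these follow from `u` and `ε`. -/
theorem exists_of_isUntwisted (hD : IsKData D) {ζ : KGroup n →* k}
    (hζ : ζ (b n) = 1) {W : KGroup n → KGroup n → k} (H : IsUntwisted D ζ W) :
    ∃ u ε : k, u ≠ 0 ∧ ε ^ 2 = 1 ∧ (ε * u ^ 2 * ζ (a n)) ^ n = 1 ∧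
      ∀ i p j r d d' : ℕ, d < 2 → d' < 2 →
        W (a n ^ (2 * i + d) * b n ^ p) (a n ^ (2 * j + d') * b n ^ r) =
          coeffFormula (ζ (a n)) u ε i d p j d' r := by
  have ma := moved_a hD
  have mb := moved_b hD
  have m2 : moved D (a n ^ 2) = false := by simpa using moved_pow hD 2 0
  have actb : D.act (b n) = b n := hD.act_b
  have act2 : D.act (a n ^ 2) = a n ^ 2 := by
    rw [map_pow, hD.act_a, mul_pow, b_sq, mul_one]
  have actab : D.act (a n * b n) = a n := by
    rw [map_mul, hD.act_a, actb, mul_assoc, b_mul_b, mul_one]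
  have l0 {s : KGroup n} (hs : moved D s = false) (g h : KGroup n) :
      W (s * g) h = W s h * W g h := by simpa [hs, tw] using H.mul_left s g h
  have r0 {s : KGroup n} (hs : moved D s = false) (g h : KGroup n) :
      W h (g * s) = W h s * W h g := by
    simpa [hs, tw] using H.mul_right g s h
  have l2 (h : KGroup n) : W (a n ^ 2) h = W (a n) h * W (a n) (D.act h) * ζ h := by
    simpa [ma, tw, sq] using H.mul_left (a n) (a n) h
  have r2 (h : KGroup n) : W h (a n ^ 2) = W h (a n) * W (D.act h) (a n) * ζ h := by
    simpa [ma, tw, sq] using H.mul_right (a n) (a n) h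
  have m1 : moved D 1 = false := by simpa using moved_pow hD 0 0
  have lone (h : KGroup n) : W 1 h = 1 := by
    have := l0 m1 1 h
    rw [mul_one] at this
    exact (mul_eq_left₀ (H.ne_zero 1 h)).1 this.symm
  have rone (g : KGroup n) : W g 1 = 1 := by
    have := r0 m1 1 g
    rw [mul_one] at this
    exact (mul_eq_left₀ (H.ne_zero g 1)).1 this.symm
  have lp {s : KGroup n} (hs : moved D s = false) (i : ℕ) (g h : KGroup n) :
      W (s ^ i * g) h = W s h ^ i * W g h := by
    induction i with
    | zero => simp
    | succ i ih => rw [pow_succ', mul_assoc, l0 hs, ih, pow_succ', mul_assoc]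
  have rp {s : KGroup n} (hs : moved D s = false) (i : ℕ) (g h : KGroup n) :
      W h (g * s ^ i) = W h s ^ i * W h g := by
    induction i with
    | zero => simp
    | succ i ih => rw [pow_succ, ← mul_assoc, r0 hs, ih, pow_succ', mul_assoc]
  have hdec (i d p : ℕ) : a n ^ (2 * i + d) * b n ^ p = (a n ^ 2) ^ i * (b n ^ p * a n ^ d) := by
    rw [pow_add, pow_mul, mul_assoc, mul_comm (a n ^ d)]
  -- In the second argument the untwisted rule splits off the right factor, so the fixed part has to
  -- stand on the right.
  have hdec' (i d p : ℕ) : a n ^ (2 * i + d) * b n ^ p = a n ^ d * b n ^ p * (a n ^ 2) ^ i := by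
    rw [hdec, mul_comm, mul_comm (b n ^ p)]
  have hL (i d p : ℕ) (h : KGroup n) : W (a n ^ (2 * i + d) * b n ^ p) h =
      W (a n ^ 2) h ^ i * (W (b n) h ^ p * W (a n ^ d) h) := by
    rw [hdec, lp m2, lp mb]
  have hR (j d r : ℕ) (h : KGroup n) : W h (a n ^ (2 * j + d) * b n ^ r) =
      W h (a n ^ 2) ^ j * (W h (b n) ^ r * W h (a n ^ d)) := by
    rw [hdec', rp m2, rp mb]
  have n0 := H.ne_zero
  set u := W (a n) (a n) with hu
  set ε := W (b n) (a n) with hε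
  -- The action exchanges `a` and `ab` and fixes `b`; its invariance carries known values to the
  -- remaining pairs.
  have v1 : W (a n * b n) (a n) = ε * u := by rw [mul_comm (a n), l0 mb]
  have v2 : W (a n) (a n * b n) = ε * u := by
    rw [← v1, ← H.act (a n * b n) (a n), actab, hD.act_a]
  have v3 : W (a n) (b n) = ε := by
    rw [r0 mb] at v2
    exact mul_right_cancel₀ (n0 _ _) v2
  have v4 : W (b n) (a n * b n) = ε := by
    rw [hε, ← H.act (b n) (a n), actb, hD.act_a]
  have v5 : W (b n) (b n) = 1 := by
    rw [r0 mb] at v4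
    exact (mul_eq_right₀ (n0 _ _)).1 v4
  -- `W(ab,ab)` equals `u` by invariance and `ε² u` by splitting off `b`.
  have hε2 : ε ^ 2 = 1 := by
    have h1 : W (a n * b n) (a n * b n) = u := by rw [hu, ← H.act (a n) (a n), hD.act_a]
    rw [mul_comm (a n), l0 mb, mul_comm (b n), v4, v2, ← mul_assoc, ← sq] at h1
    exact (mul_eq_right₀ (n0 _ _)).1 h1
  have v6 : W (b n) (a n ^ 2) = 1 := by rw [r2, actb, hζ, mul_one, ← hε, ← sq, hε2]
  have v7 : W (a n ^ 2) (b n) = 1 := by rw [l2, actb, hζ, mul_one, v3, ← sq, hε2]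
  have v8 : W (a n ^ 2) (a n) = ε * u ^ 2 * ζ (a n) := by
    rw [l2, hD.act_a, v2, ← hu]; ring
  have v9 : W (a n) (a n ^ 2) = ε * u ^ 2 * ζ (a n) := by
    rw [r2, hD.act_a, v1, ← hu]; ring
  have v10 : W (a n ^ 2) (a n ^ 2) = (ε * u ^ 2 * ζ (a n) * ζ (a n)) ^ 2 := by
    rw [l2, act2, v9, map_pow]; ring
  refine ⟨u, ε, n0 _ _, hε2, ?_, fun i p j r d d' hd hd' => ?_⟩
  -- `ε u² ζ(a)` is `W(a²,a)`, and its `n`-th power is `W(a^(2n),a) = W(1,a) = 1`.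
  · rw [← v8]
    have := lp m2 n 1 (a n)
    rw [lone, mul_one, mul_one, ← pow_mul, a_pow_two_mul, lone] at this
    exact this.symm
  · unfold coeffFormula
    rw [hL, hR, hR, hR, v5, v6, v7, v10]
    generalize hq : ε * u ^ 2 * ζ (a n) = q at *
    interval_cases d <;> interval_cases d' <;>
      simp only [pow_zero, pow_one, rone, lone, v3, v8, v9, ← hu, ← hε, one_pow, one_mul,
        mul_one, mul_zero, add_zero] <;> ring

/-- The three root-of-unity hypotheses are exactly what absorbs the change of exponents under `i ↦ i
+ n` and `p ↦ p + 2`. Symmetry of the formula then handles the second argument. -/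
theorem coeffFormula_spec {u ε z : k} (hε : ε ^ 2 = 1) (hq : (ε * u ^ 2 * z) ^ n = 1)
    (hz : z ^ (2 * n) = 1) [NeZero n] : ∃ W : KGroup n → KGroup n → k,
      ∀ i p j r d d' : ℕ, d < 2 → d' < 2 →
        W (a n ^ (2 * i + d) * b n ^ p) (a n ^ (2 * j + d') * b n ^ r) =
          coeffFormula z u ε i d p j d' r := by
  have e1 (m : ℕ) : ε ^ (2 * m) = 1 := by rw [pow_mul, hε, one_pow]
  have q1 (m : ℕ) : (ε * u ^ 2 * z) ^ (n * m) = 1 := by rw [pow_mul, hq, one_pow]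
  have z1 (m : ℕ) : z ^ (2 * n * m) = 1 := by rw [pow_mul, hz, one_pow]
  have s1 (i d p j d' r : ℕ) : coeffFormula z u ε (i + n) d p j d' r =
      coeffFormula z u ε i d p j d' r := by
    unfold coeffFormula
    have h1 : 2 * (i + n) * j + (i + n) * d' + j * d =
      2 * i * j + i * d' + j * d + n * (2 * j + d') := by ring
    have h2 : 2 * (i + n) * j = 2 * i * j + 2 * n * j := by ring
    rw [h1, h2, pow_add _ _ (n * _), pow_add _ _ (2 * n * j), q1, z1, mul_one, mul_one]
  have s2 (i d p j d' r : ℕ) : coeffFormula z u ε i d (p + 2) j d' r =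
      coeffFormula z u ε i d p j d' r := by
    unfold coeffFormula
    have h1 : (p + 2) * d' + r * d = p * d' + r * d + 2 * d' := by ring
    rw [h1, pow_add _ _ (2 * _), e1, mul_one]
  have s3 (i d p j d' r : ℕ) : coeffFormula z u ε i d p j d' r =
      coeffFormula z u ε j d' r i d p := by
    unfold coeffFormula
    ring
  have hdiv (i : ℕ) : (i + 2 * n) / 2 = i / 2 + n := by omega
  have hmod (i : ℕ) : (i + 2 * n) % 2 = i % 2 := by omega
  obtain ⟨W, hW⟩ := exists_fun_of_periodic (n := n)
    (fun i p j r => coeffFormula z u ε (i / 2) (i % 2) p (j / 2) (j % 2) r)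
    (fun i p j r => by rw [hdiv, hmod, s1])
    (fun i p j r => by rw [s2])
    (fun i p j r => by rw [s3, hdiv, hmod, s1, s3])
    (fun i p j r => by rw [s3, s2, s3])
  refine ⟨W, fun i p j r d d' hd hd' => ?_⟩
  rw [hW]
  congr 1 <;> omega

theorem isUntwisted_of_eq [NeZero n] (hD : IsKData D) {ζ : KGroup n →* k}
    (hζ : ζ (b n) = 1) {u ε : k} (hu : u ≠ 0) (hε : ε ^ 2 = 1)
    {W : KGroup n → KGroup n → k}
    (hW : ∀ i p j r d d' : ℕ, d < 2 → d' < 2 →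
        W (a n ^ (2 * i + d) * b n ^ p) (a n ^ (2 * j + d') * b n ^ r) =
          coeffFormula (ζ (a n)) u ε i d p j d' r) : IsUntwisted D ζ W := by
  have hz : ζ (a n) ≠ 0 := by
    intro h
    have := map_pow ζ (a n) (2 * n)
    rw [a_pow_two_mul, map_one, h, zero_pow (by simp [NeZero.ne n])] at this
    exact one_ne_zero this
  have hε0 : ε ≠ 0 := by
    rintro rfl
    simp at hε
  have hg (g : KGroup n) : ∃ i p d, d < 2 ∧ g = a n ^ (2 * i + d) * b n ^ p := by
    obtain ⟨i, -, p, -, rfl⟩ := exists_eq_pow g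
    exact ⟨i / 2, p, i % 2, Nat.mod_lt _ two_pos, by rw [Nat.div_add_mod]⟩
  have m0 (i p : ℕ) : moved D (a n ^ (2 * i) * b n ^ p) = false := by
    simp [moved_pow hD]
  have m1 (i p : ℕ) : moved D (a n ^ (2 * i + 1) * b n ^ p) = true := by
    simp [moved_pow hD, Nat.add_mod]
  have hab (i p i' p' : ℕ) : a n ^ i * b n ^ p * (a n ^ i' * b n ^ p') =
      a n ^ (i + i') * b n ^ (p + p') := by
    rw [mul_mul_mul_comm, ← pow_add, ← pow_add]
  have hζ' (i p : ℕ) : ζ (a n ^ i * b n ^ p) = ζ (a n) ^ i := by simp [hζ]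
  have W00 (i p j r : ℕ) := hW i p j r 0 0 two_pos two_pos
  have W01 (i p j r : ℕ) := hW i p j r 0 1 two_pos one_lt_two
  have W10 (i p j r : ℕ) := hW i p j r 1 0 one_lt_two two_pos
  have W11 (i p j r : ℕ) := hW i p j r 1 1 one_lt_two one_lt_two
  have e1 (m : ℕ) : ε ^ (2 * m) = 1 := by rw [pow_mul, hε, one_pow]
  simp only [add_zero] at W00 W01 W10 W11
  have hodd (i j : ℕ) : 2 * i + 1 + 2 * j = 2 * (i + j) + 1 := by ring
  have hodd' (i j : ℕ) : 2 * i + (2 * j + 1) = 2 * (i + j) + 1 := by ring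
  have hodd2 (i j : ℕ) : 2 * i + 1 + (2 * j + 1) = 2 * (i + j + 1) := by ring
  refine ⟨fun g h => ?_, fun g g' h => ?_, fun g g' h => ?_, fun g h => ?_⟩
  · obtain ⟨i, p, d, hd, rfl⟩ := hg g
    obtain ⟨j, r, d', hd', rfl⟩ := hg h
    rw [hW _ _ _ _ _ _ hd hd']
    unfold coeffFormula
    positivity
  · obtain ⟨i, p, d, hd, rfl⟩ := hg g
    obtain ⟨i', p', d', hd', rfl⟩ := hg g'
    obtain ⟨j, r, d'', hd'', rfl⟩ := hg h
    interval_cases d <;> interval_cases d' <;> interval_cases d'' <;>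
      simp only [add_zero, hab, m0, m1, tw, cond_true, cond_false, Bool.and_true, Bool.and_false,
        act_pow hD, ← mul_add, hodd, hodd', hodd2, W00, W01, W10,
        W11, hζ', coeffFormula] <;>
      -- When both multiplied elements are odd, twisting the remaining argument produces a surplus
      -- `ε^(2(r+j)) = 1`, which has to be inserted by hand.
      first
      | ring1
      | refine (mul_one _).symm.trans ((congrArg _ (e1 (r + j)).symm).trans ?_)
        ring
  · obtain ⟨i, p, d, hd, rfl⟩ := hg g
    obtain ⟨i', p', d', hd', rfl⟩ := hg g'
    obtain ⟨j, r, d'', hd'', rfl⟩ := hg h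
    interval_cases d <;> interval_cases d' <;> interval_cases d'' <;>
      simp only [add_zero, hab, m0, m1, tw, cond_true, cond_false, Bool.and_true, Bool.and_false,
        act_pow hD, ← mul_add, hodd, hodd', hodd2, W00, W01, W10,
        W11, hζ', coeffFormula] <;>
      first
      | ring1
      | refine (mul_one _).symm.trans ((congrArg _ (e1 (r + j)).symm).trans ?_)
        ring
  · obtain ⟨i, p, d, hd, rfl⟩ := hg g
    obtain ⟨j, r, d', hd', rfl⟩ := hg h
    rw [act_pow hD, act_pow hD, hW _ _ _ _ _ _ hd hd', hW _ _ _ _ _ _ hd hd']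
    unfold coeffFormula
    have h1 : (p + (2 * i + d)) * d' + (r + (2 * j + d')) * d =
      p * d' + r * d + 2 * (i * d' + j * d + d * d') := by ring
    rw [h1, pow_add ε, e1, mul_one]

end KAlg

/-! ### The coefficients of `R'` in terms of `u`, `ε`, `ζ(a)` and `c` -/

namespace KAlg

open KGroup AbExt

section Formulas

variable {k : Type*} [Field k] {n : ℕ} {D : AbExtData k (KGroup n)} {c : KGroup n → kˣ}

theorem coe_one_of_coboundary (hc : ∀ g h, (D.τ g h * c (g * h) : k) = c g * c h) :
    (c 1 : k) = 1 := by
  have := hc 1 1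
  rw [D.τ_one_left, mul_one, Units.val_one, one_mul] at this
  exact (mul_eq_left₀ (c 1).ne_zero).1 this.symm

theorem tau_eq_div (hc : ∀ g h, (D.τ g h * c (g * h) : k) = c g * c h) (g h : KGroup n) :
    (D.τ g h : k) = c g * c h / c (g * h) :=
  eq_div_of_mul_eq (c (g * h)).ne_zero (hc g h)

theorem P_succ (i : ℕ) : P D (i + 1) = P D i * D.τ (a n) (a n ^ i) := by
  rcases Nat.eq_zero_or_pos i with rfl | hi
  · simp [P, D.τ_one_right]
  · rw [P, P, Finset.prod_Ico_succ_top hi]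

/-- The product telescopes once `τ` is written as a coboundary. -/
theorem P_eq (hc : ∀ g h, (D.τ g h * c (g * h) : k) = c g * c h) (i : ℕ) :
    P D i = (c (a n) : k) ^ i / c (a n ^ i) := by
  induction i with
  | zero => simp [P, coe_one_of_coboundary hc]
  | succ i ih =>
    rw [P_succ, ih, tau_eq_div hc, pow_succ' (a n)]
    field_simp
    ring

theorem lam_eq (hc : ∀ g h, (D.τ g h * c (g * h) : k) = c g * c h) (i j : ℕ) :
    lam D i j = c (a n ^ i) / (c (a n) : k) ^ i * (D.σ (a n ^ j) : k) ^ (i / 2) := by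
  rw [lam, P_eq hc, inv_div]

variable (D c) in
/-- The character `g ↦ σ(g) c(g) c(g ◁ x)`. -/
def zetaHom (hc : ∀ g h, (D.τ g h * c (g * h) : k) = c g * c h) : KGroup n →* k where
  toFun g := D.σ g * c g * c (D.act g)
  map_one' := by simp [D.σ_one, coe_one_of_coboundary hc]
  map_mul' g h := by
    rw [← σ_mul', map_mul]
    have h1 := hc g h
    have h2 := hc (D.act g) (D.act h)
    linear_combination (D.σ g : k) * D.σ h * D.τ (D.act g) (D.act h) *
      c (D.act g * D.act h) * h1 + (D.σ g : k) * D.σ h * (c g * c h) * h2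

variable (hc : ∀ g h, (D.τ g h * c (g * h) : k) = c g * c h)

/-- The character is symmetric in `g` and `g ◁ x`, so it takes the same value at `a` and `ab`. -/
theorem zetaHom_b (hD : IsKData D) : zetaHom D c hc (b n) = 1 := by
  have h1 : zetaHom D c hc (D.act (a n)) = zetaHom D c hc (a n) := by
    simp only [zetaHom, MonoidHom.coe_mk, OneHom.coe_mk, D.σ_act, D.act_act]
    ring
  rw [hD.act_a, map_mul] at h1
  have h0 : zetaHom D c hc (a n) ≠ 0 := by simp [zetaHom]
  exact (mul_eq_left₀ h0).1 h1

theorem act_a_pow_even (hD : IsKData D) (j : ℕ) : D.act (a n ^ (2 * j)) = a n ^ (2 * j) := by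
  rw [map_pow, hD.act_a, mul_pow, pow_mul (b n), b_sq, one_pow, mul_one]

theorem act_a_pow_odd (hD : IsKData D) (j : ℕ) :
    D.act (a n ^ (2 * j + 1)) = a n ^ (2 * j + 1) * b n := by
  rw [pow_succ, map_mul, act_a_pow_even hD, hD.act_a, mul_assoc]

theorem act_a_pow_odd_mul_b (hD : IsKData D) (j : ℕ) :
    D.act (a n ^ (2 * j + 1) * b n) = a n ^ (2 * j + 1) := by
  rw [map_mul, act_a_pow_odd hD, hD.act_b, mul_assoc, b_mul_b, mul_one]

theorem sigma_even (hD : IsKData D) (j : ℕ) : (D.σ (a n ^ (2 * j)) : k) =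
    zetaHom D c hc (a n) ^ (2 * j) / (c (a n ^ (2 * j)) : k) ^ 2 := by
  rw [← map_pow]
  simp only [zetaHom, MonoidHom.coe_mk, OneHom.coe_mk, act_a_pow_even hD]
  field_simp

theorem sigma_odd (hD : IsKData D) (j : ℕ) : (D.σ (a n ^ (2 * j + 1)) : k) =
    zetaHom D c hc (a n) ^ (2 * j + 1) /
      (c (a n ^ (2 * j + 1)) * c (a n ^ (2 * j + 1) * b n)) := by
  rw [← map_pow]
  simp only [zetaHom, MonoidHom.coe_mk, OneHom.coe_mk, act_a_pow_odd hD]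
  field_simp

theorem sigma_a (hD : IsKData D) : (D.σ (a n) : k) =
    zetaHom D c hc (a n) / (c (a n) * c (a n * b n)) := by
  simpa using sigma_odd hc hD 0

/-- The two values of `τ` belong to pairs with the same product, so the `c` of the product cancels.
-/
theorem hFun_mul_b_left (hc : ∀ g h, (D.τ g h * c (g * h) : k) = c g * c h)
    (hD : IsKData D) (i j : ℕ) :
    hFun D (a n ^ (2 * i + 1) * b n) (a n ^ (2 * j + 1)) =
      c (a n ^ (2 * i + 1) * b n) * c (a n ^ (2 * j + 1)) /
        (c (a n ^ (2 * j + 1) * b n) * c (a n ^ (2 * i + 1)) : k) := by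
  rw [hFun, act_a_pow_odd hD, act_a_pow_odd_mul_b hD, tau_eq_div hc, tau_eq_div hc,
    show a n ^ (2 * j + 1) * b n * a n ^ (2 * i + 1) =
      a n ^ (2 * i + 1) * b n * a n ^ (2 * j + 1) by ac_rfl]
  field_simp

theorem hFun_mul_b_right (hc : ∀ g h, (D.τ g h * c (g * h) : k) = c g * c h)
    (hD : IsKData D) (i j : ℕ) :
    hFun D (a n ^ (2 * i + 1)) (a n ^ (2 * j + 1) * b n) =
      c (a n ^ (2 * i + 1)) * c (a n ^ (2 * j + 1) * b n) /
        (c (a n ^ (2 * j + 1)) * c (a n ^ (2 * i + 1) * b n) : k) := by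
  rw [hFun, act_a_pow_odd hD, act_a_pow_odd_mul_b hD, tau_eq_div hc, tau_eq_div hc,
    show a n ^ (2 * j + 1) * (a n ^ (2 * i + 1) * b n) =
      a n ^ (2 * i + 1) * (a n ^ (2 * j + 1) * b n) by ac_rfl]
  field_simp

theorem hFun_mul_b_mul_b (hc : ∀ g h, (D.τ g h * c (g * h) : k) = c g * c h)
    (hD : IsKData D) (i j : ℕ) :
    hFun D (a n ^ (2 * i + 1) * b n) (a n ^ (2 * j + 1) * b n) =
      c (a n ^ (2 * i + 1) * b n) * c (a n ^ (2 * j + 1) * b n) /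
        (c (a n ^ (2 * j + 1)) * c (a n ^ (2 * i + 1)) : k) := by
  rw [hFun, act_a_pow_odd_mul_b hD, act_a_pow_odd_mul_b hD, tau_eq_div hc, tau_eq_div hc,
    mul_mul_mul_comm, b_mul_b, mul_one, mul_comm (a n ^ (2 * j + 1)) (a n ^ (2 * i + 1))]
  field_simp

/-- `α` and `β` are the coefficients `w⁴(a,a)` and `w⁴(a,ab)`, which forces this substitution.
Likewise `S_{j,0}` and `S_{j,1}` are the coefficients of `R'` at `(a, a^(2j+1))` and `(a, a^(2j+1)
b)`. -/
theorem S0_eq (hD : IsKData D) {u ε : k} (j : ℕ) :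
    S0 D (u * c (a n) ^ 2) (ε * u * c (a n) * c (a n * b n)) j =
      (ε * u ^ 2 * zetaHom D c hc (a n)) ^ j * u * c (a n) * c (a n ^ (2 * j + 1)) := by
  rw [S0, lam_eq hc, pow_one, sigma_a hc hD, show (2 * j + 1) / 2 = j by omega, div_pow]
  field_simp
  ring

theorem S1_eq (hD : IsKData D) {u ε : k} (j : ℕ) :
    S1 D (u * c (a n) ^ 2) (ε * u * c (a n) * c (a n * b n)) j =
      (ε * u ^ 2 * zetaHom D c hc (a n)) ^ j * (ε * u) * c (a n) *
        c (a n ^ (2 * j + 1) * b n) := by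
  have h := hFun_mul_b_right hc hD 0 j
  rw [mul_zero, zero_add, pow_one] at h
  rw [S1, h, lam_eq hc, pow_one, sigma_a hc hD, show (2 * j + 1) / 2 = j by omega, div_pow]
  field_simp
  ring

/-- The factors `c(a^(2j+1)) c(a^(2j+1) b)` of `S_{j,0} S_{j,1}` cancel the denominator of
`σ(a^(2j+1))`. The even case of `m` serves `w2`, the odd case `w4`. -/
theorem lam_mul_S0_mul_S1_pow (hD : IsKData D) {u ε : k} (m j : ℕ) :
    lam D m (2 * j + 1) * (S0 D (u * c (a n) ^ 2) (ε * u * c (a n) * c (a n * b n)) j *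
      S1 D (u * c (a n) ^ 2) (ε * u * c (a n) * c (a n * b n)) j) ^ (m / 2) =
      c (a n ^ m) / (c (a n) : k) ^ m * ((ε * u ^ 2 * zetaHom D c hc (a n)) ^ (2 * j + 1) *
        zetaHom D c hc (a n) ^ (2 * j) * c (a n) ^ 2) ^ (m / 2) := by
  rw [lam_eq hc, mul_assoc, ← mul_pow, S0_eq hc hD, S1_eq hc hD, sigma_odd hc hD]
  congr 2
  field_simp
  ring

theorem tau_ratio (hc : ∀ g h, (D.τ g h * c (g * h) : k) = c g * c h)
    {u ε : k} (hu : u ≠ 0) (m : ℕ) :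
    (D.τ (b n) (a n) * (ε * u * c (a n) * c (a n * b n))) /
      (D.τ (b n) (a n ^ m) * (u * c (a n) ^ 2)) = ε * c (a n ^ m * b n) / (c (a n ^ m) : k) := by
  rw [tau_eq_div hc, tau_eq_div hc, mul_comm (b n) (a n), mul_comm (b n) (a n ^ m)]
  field_simp

/-- `p` and `q` are arbitrary because `coeffFormula` ignores them when both parities are `0`. -/
theorem w1_eq (hD : IsKData D) {u ε : k} (i j p q : ℕ) :
    w1 D (u * c (a n) ^ 2) (ε * u * c (a n) * c (a n * b n)) i j =
      coeffFormula (zetaHom D c hc (a n)) u ε i 0 p j 0 q := by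
  rw [w1, coeffFormula, lam_eq hc, pow_one, sigma_a hc hD, sigma_even hc hD,
    show (2 * j) / 2 = j by omega]
  simp only [mul_zero, add_zero, pow_zero, mul_one, div_pow, mul_pow]
  field_simp
  ring

theorem w2_zero_eq (hD : IsKData D) {u ε : k} (i j q : ℕ) :
    w2 D (u * c (a n) ^ 2) (ε * u * c (a n) * c (a n * b n)) i 0 j =
      coeffFormula (zetaHom D c hc (a n)) u ε i 0 0 j 1 q * c (a n ^ (2 * i)) := by
  have h := lam_mul_S0_mul_S1_pow hc hD (u := u) (ε := ε) (2 * i) j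
  rw [show (2 * i) / 2 = i by omega] at h
  rw [w2, h, coeffFormula]
  field_simp
  ring

theorem w2_one_eq (hD : IsKData D) {u ε : k} (hu : u ≠ 0) (i j q : ℕ) :
    w2 D (u * c (a n) ^ 2) (ε * u * c (a n) * c (a n * b n)) i 1 j =
      coeffFormula (zetaHom D c hc (a n)) u ε i 0 1 j 1 q * c (a n ^ (2 * i) * b n) := by
  have h := w2_zero_eq hc hD (u := u) (ε := ε) i j q
  rw [w2] at h
  rw [w2, mul_assoc, h, tau_ratio hc hu, coeffFormula, coeffFormula]
  field_simp
  ring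

theorem w3_eq_w2 {α β : k} (i j : ℕ) (q : Fin 2) : w3 D α β i j q = w2 D α β j q i := by
  fin_cases q <;> rfl

theorem coeffFormula_comm (z u ε : k) (i d p j d' r : ℕ) :
    coeffFormula z u ε i d p j d' r = coeffFormula z u ε j d' r i d p := by
  unfold coeffFormula
  ring

theorem w4_zero_zero_eq (hD : IsKData D) {u ε : k} (i j : ℕ) :
    w4 D (u * c (a n) ^ 2) (ε * u * c (a n) * c (a n * b n)) i 0 j 0 =
      coeffFormula (zetaHom D c hc (a n)) u ε i 1 0 j 1 0 *
        (c (a n ^ (2 * i + 1)) * c (a n ^ (2 * j + 1))) := by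
  have h := lam_mul_S0_mul_S1_pow hc hD (u := u) (ε := ε) (2 * i + 1) j
  rw [show (2 * i + 1) / 2 = i by omega, mul_pow] at h
  rw [w4, show ∀ x y w : k, x * y ^ (i + 1) * w ^ i = x * (y ^ i * w ^ i) * y by intros; ring, h,
    S0_eq hc hD, coeffFormula]
  field_simp
  ring

theorem w4_zero_one_eq (hD : IsKData D) {u ε : k} (i j : ℕ) :
    w4 D (u * c (a n) ^ 2) (ε * u * c (a n) * c (a n * b n)) i 0 j 1 =
      coeffFormula (zetaHom D c hc (a n)) u ε i 1 0 j 1 1 *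
        (c (a n ^ (2 * i + 1)) * c (a n ^ (2 * j + 1) * b n)) := by
  have h := lam_mul_S0_mul_S1_pow hc hD (u := u) (ε := ε) (2 * i + 1) j
  rw [show (2 * i + 1) / 2 = i by omega, mul_pow] at h
  rw [w4, show ∀ x y w : k, x * y ^ i * w ^ (i + 1) = x * (y ^ i * w ^ i) * w by intros; ring, h,
    S1_eq hc hD, coeffFormula]
  field_simp
  ring

theorem w4_one_zero_eq (hD : IsKData D) {u ε : k} (i j : ℕ) :
    w4 D (u * c (a n) ^ 2) (ε * u * c (a n) * c (a n * b n)) i 1 j 0 =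
      coeffFormula (zetaHom D c hc (a n)) u ε i 1 1 j 1 0 *
        (c (a n ^ (2 * i + 1) * b n) * c (a n ^ (2 * j + 1))) := by
  have h := w4_zero_one_eq hc hD (u := u) (ε := ε) i j
  rw [w4] at h
  rw [w4, mul_assoc, mul_assoc, ← mul_assoc (lam D _ _), h, hFun_mul_b_left hc hD,
    coeffFormula, coeffFormula]
  field_simp

/-- `R'` reuses the expression from `(0,0)` here, while `coeffFormula` gains a factor `ε²`; this is
where `ε² = 1` enters. -/
theorem w4_one_one_eq (hD : IsKData D) {u ε : k} (hε : ε ^ 2 = 1) (i j : ℕ) :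
    w4 D (u * c (a n) ^ 2) (ε * u * c (a n) * c (a n * b n)) i 1 j 1 =
      coeffFormula (zetaHom D c hc (a n)) u ε i 1 1 j 1 1 *
        (c (a n ^ (2 * i + 1) * b n) * c (a n ^ (2 * j + 1) * b n)) := by
  have h := w4_zero_zero_eq hc hD (u := u) (ε := ε) i j
  rw [w4] at h
  rw [w4, mul_assoc, mul_assoc, ← mul_assoc (lam D _ _), h, hFun_mul_b_mul_b hc hD,
    coeffFormula, coeffFormula]
  simp only [mul_one, add_zero, hε, one_add_one_eq_two, pow_zero]
  field_simp

/-- All factors `c` cancel: in the first condition because `c(a^(2n)) = c(1) = 1`, in the second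
because `τ(b,b)/τ(b,a)² = (c(ab)/c(a))²`. -/
theorem constraints_iff [NeZero n] (hD : IsKData D) {u ε : k} (hu : u ≠ 0) :
    ((u * c (a n) ^ 2 * (ε * u * c (a n) * c (a n * b n))) ^ n * lam D (2 * n) 1 = 1 ∧
      (ε * u * c (a n) * c (a n * b n)) ^ 2 / (u * c (a n) ^ 2) ^ 2 =
        (D.τ (b n) (b n) / D.τ (b n) (a n) ^ 2 : k)) ↔
      (ε * u ^ 2 * zetaHom D c hc (a n)) ^ n = 1 ∧ ε ^ 2 = 1 := by
  have h1 : (u * c (a n) ^ 2 * (ε * u * c (a n) * c (a n * b n))) ^ n * lam D (2 * n) 1 =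
      (ε * u ^ 2 * zetaHom D c hc (a n)) ^ n := by
    rw [lam_eq hc, a_pow_two_mul, coe_one_of_coboundary hc, pow_one, sigma_a hc hD,
      show (2 * n) / 2 = n by omega, pow_mul (c (a n) : k), ← one_div_pow, ← mul_pow, ← mul_pow]
    congr 1
    field_simp
  have h2 : (ε * u * c (a n) * c (a n * b n)) ^ 2 / (u * c (a n) ^ 2) ^ 2 =
      ε ^ 2 * (D.τ (b n) (b n) / D.τ (b n) (a n) ^ 2 : k) := by
    rw [tau_eq_div hc, tau_eq_div hc, b_mul_b, coe_one_of_coboundary hc, mul_comm (b n) (a n)]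
    field_simp
  rw [h1, h2]
  exact and_congr_right fun _ => mul_eq_right₀ (by simp)

end Formulas

/-! ### The classification of the non-trivial structures and the theorem -/

section Classification

variable {k : Type*} [Field k] {n : ℕ} {D : AbExtData k (KGroup n)} {c : KGroup n → kˣ}

theorem rMat_eq_rPrime [NeZero n] (hc : ∀ g h, (D.τ g h * c (g * h) : k) = c g * c h)
    (hD : IsKData D) {u ε : k} (hu : u ≠ 0) (hε : ε ^ 2 = 1) {W : KGroup n → KGroup n → k}
    (hW : ∀ i p j r d d' : ℕ, d < 2 → d' < 2 →
        W (a n ^ (2 * i + d) * b n ^ p) (a n ^ (2 * j + d') * b n ^ r) =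
          coeffFormula (zetaHom D c hc (a n)) u ε i d p j d' r) :
    rMat D (moved D)
      (fun g h => W g h * (cond (moved D h) (c g : k) 1 * cond (moved D g) (c h : k) 1)) =
      RPrime D (u * c (a n) ^ 2) (ε * u * c (a n) * c (a n * b n)) := by
  have m0 (i p : ℕ) : moved D (a n ^ (2 * i) * b n ^ p) = false := by
    simp [moved_pow hD]
  have m1 (i p : ℕ) : moved D (a n ^ (2 * i + 1) * b n ^ p) = true := by
    simp [moved_pow hD, Nat.add_mod]
  have W00 (i p j r : ℕ) := hW i p j r 0 0 two_pos two_pos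
  have W01 (i p j r : ℕ) := hW i p j r 0 1 two_pos one_lt_two
  have W10 (i p j r : ℕ) := hW i p j r 1 0 one_lt_two two_pos
  have W11 (i p j r : ℕ) := hW i p j r 1 1 one_lt_two one_lt_two
  simp only [add_zero] at W00 W01 W10 W11
  refine rPrime_eq hD (fun i j p q => ?_) (fun i j p q => ?_) (fun i j p q => ?_)
    (fun i j p q => ?_)
  · simp only [m0, W00, cond_false, mul_one]
    exact (w1_eq hc hD i j p q).symm
  · simp only [m0, m1, W01, cond_false, cond_true, mul_one]
    fin_cases p
    · simpa using (w2_zero_eq hc hD i j q).symm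
    · simpa using (w2_one_eq hc hD hu i j q).symm
  · simp only [m0, m1, W10, cond_false, cond_true, one_mul]
    -- Both `R'` and the normalized formula are symmetric under exchanging the legs here, which
    -- reduces to the `S × T` block.
    rw [w3_eq_w2, coeffFormula_comm]
    fin_cases q
    · simpa using (w2_zero_eq hc hD j i p).symm
    · simpa using (w2_one_eq hc hD hu j i p).symm
  · simp only [m1, W11, cond_true]
    fin_cases p <;> fin_cases q
    · simpa using (w4_zero_zero_eq hc hD i j).symm
    · simpa using (w4_zero_one_eq hc hD i j).symm
    · simpa using (w4_one_zero_eq hc hD i j).symm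
    · simpa using (w4_one_one_eq hc hD hε i j).symm

/-- The classification of the non-trivial structures. -/
theorem isNontrivialStructure_iff_exists [NeZero n] (hD : IsKData D)
    (hc : ∀ g h, (D.τ g h * c (g * h) : k) = c g * c h) (R : AbExt D ⊗[k] AbExt D) :
    IsNontrivialStructure D R ↔ ∃ α β : k, (α * β) ^ n * lam D (2 * n) 1 = 1 ∧
      β ^ 2 / α ^ 2 = D.τ (b n) (b n) / D.τ (b n) (a n) ^ 2 ∧ R = RPrime D α β := by
  rw [isNontrivialStructure_iff hD]
  constructor
  · rintro ⟨w, rfl, H⟩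
    -- The rescaling factors are nonzero, so any coefficient function can be normalized.
    obtain ⟨W, rfl⟩ : ∃ W : KGroup n → KGroup n → k, w = fun g h =>
        W g h * (cond (moved D h) (c g : k) 1 * cond (moved D g) (c h : k) 1) := by
      refine ⟨fun g h => w g h / (cond (moved D h) (c g : k) 1 * cond (moved D g) (c h : k) 1),
        funext fun g => funext fun h => (div_mul_cancel₀ _ ?_).symm⟩
      cases moved D g <;> cases moved D h <;> simp
    have hU : IsUntwisted D (zetaHom D c hc) W := (isRFunction_moved_iff hD hc W).1 H
    obtain ⟨u, ε, hu, hε, hq, hW⟩ := exists_of_isUntwisted hD (zetaHom_b hc hD) hU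
    obtain ⟨h1, h2⟩ := (constraints_iff hc hD hu).2 ⟨hq, hε⟩
    exact ⟨_, _, h1, h2, rMat_eq_rPrime hc hD hu hε hW⟩
  · rintro ⟨α, β, h1, h2, rfl⟩
    -- For `α = 0` the quotient `β² / α²` is `0` by convention, but the other side is a unit.
    have hα : α ≠ 0 := by
      rintro rfl
      have h0 : (D.τ (b n) (b n) / D.τ (b n) (a n) ^ 2 : k) ≠ 0 := by simp
      rw [zero_pow two_ne_zero, div_zero] at h2
      exact h0 h2.symm
    obtain ⟨u, hu⟩ : ∃ u, α = u * c (a n) ^ 2 := ⟨α / c (a n) ^ 2, by field_simp⟩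
    have hu0 : u ≠ 0 := by
      rintro rfl
      exact hα (by rw [hu, zero_mul])
    -- Only `u ≠ 0` is needed to solve for `ε`; that `β ≠ 0` follows afterwards from `ε² = 1`.
    obtain ⟨ε, hε⟩ : ∃ ε, β = ε * u * c (a n) * c (a n * b n) :=
      ⟨β / (u * c (a n) * c (a n * b n)), by field_simp⟩
    subst hu hε
    obtain ⟨hq, hε⟩ := (constraints_iff hc hD hu0).1 ⟨h1, h2⟩
    have hz : zetaHom D c hc (a n) ^ (2 * n) = 1 := by rw [← map_pow, a_pow_two_mul, map_one]
    obtain ⟨W, hW⟩ := coeffFormula_spec (n := n) hε hq hz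
    refine ⟨_, (rMat_eq_rPrime hc hD hu0 hε hW).symm, (isRFunction_moved_iff hD hc W).2 ?_⟩
    exact isUntwisted_of_eq hD (zetaHom_b hc hD) hu0 hε hW

end Classification

end KAlg

theorem mainTheorem9 {k : Type*} [Field k] [IsAlgClosed k] [CharZero k] (n : ℕ) [NeZero n]
    (D : AbExtData k (KGroup n)) (hD : IsKData D)
    (hη : KAlg.eta D (KGroup.a n) (KGroup.b n) = 1) :
    {R : AbExt D ⊗[k] AbExt D | AbExt.IsNontrivialStructure D R} =
        {R | ∃ α β : k, (α * β) ^ n * KAlg.lam D (2 * n) 1 = 1 ∧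
          β ^ 2 / α ^ 2 = D.τ (KGroup.b n) (KGroup.b n) / D.τ (KGroup.b n) (KGroup.a n) ^ 2 ∧
          R = KAlg.RPrime D α β} ∧
      {R : AbExt D ⊗[k] AbExt D | AbExt.IsTrivialStructure D R} =
        {R | ∃ α β : k, α ^ (2 * n) = 1 ∧ β ^ 2 = 1 ∧ R = KAlg.RTrivial D α β} := by
  obtain ⟨c, hc⟩ := KAlg.exists_tau_eq hη
  have hc' (g h : KGroup n) : (D.τ g h * c (g * h) : k) = c g * c h :=
    mod_cast congrArg Units.val (hc g h)
  exact ⟨Set.ext fun R => KAlg.isNontrivialStructure_iff_exists hD hc' R,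
    Set.ext fun R => KAlg.isTrivialStructure_iff_exists hD (KAlg.tau_symm hη) R⟩
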